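/- Let $p>1$ be real and let $\mathcal E_n=1$ ($\mathcal O_n=1$) if $n$ is even (odd), and $0$ otherwise. Let $V(p)$ be the Hilbert space (paraboson Fock space of $\mathfrak{osp}(1|4)$) with orthonormal basis $|m_{12},m_{22};m_{11})$ indexed by the integers with $m_{12}\ge m_{11}\ge m_{22}\ge 0$. On finite combinations of basis vectors define $$b_1^+|m_{12},m_{22};m_{11})=\sqrt{m_{11}-m_{22}+1}\,f_1(m_{12},m_{22})\,|m_{12}+1,m_{22};m_{11}+1)-\sqrt{m_{12}-m_{11}}\,f_2(m_{12},m_{22})\,|m_{12},m_{22}+1;m_{11}+1),$$ $$b_1^-|m_{12},m_{22};m_{11})=\sqrt{m_{11}-m_{22}}\,f_1(m_{12}-1,m_{22})\,|m_{12}-1,m_{22};m_{11}-1)-\sqrt{m_{12}-m_{11}+1}\,f_2(m_{12},m_{22}-1)\,|m_{12},m_{22}-1;m_{11}-1),$$ $h_1|m_{12},m_{22};m_{11})=(\tfrac p2+m_{11})|m_{12},m_{22};m_{11})$, $h_2|m_{12},m_{22};m_{11})=(\tfrac p2+m_{12}+m_{22}-m_{11})|m_{12},m_{22};m_{11})$,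 where $$f_1(a,b)=(-1)^b\Big(\frac{a+2+\mathcal E_a(p-2)}{a-b+1+\mathcal O_{a-b}}\Big)^{1/2},\qquad f_2(a,b)=\Big(\frac{b+1+\mathcal E_b(p-2)}{a-b+1-\mathcal O_{a-b}}\Big)^{1/2},$$ and symbols $|a,b;c)$ that violate $a\ge c\ge b\ge0$ are read as $0$. Let $0\le j\le k$ be integers. Then there is a unit vector $|\zeta_{jk}\rangle$, a finite combination of basis vectors, with $h_1|\zeta_{jk}\rangle=(\frac p2+j)|\zeta_{jk}\rangle$, $h_2|\zeta_{jk}\rangle=(\frac p2+k)|\zeta_{jk}\rangle$ and $b_1^-|\zeta_{jk}\rangle=0$, and it is unique up to a phase. Fix any such vector. Let $\mathcal V_{\langle j\rangle,k}$ be the closed linear span of the vectors $(b_1^+)^n|\zeta_{jk}\rangle$, $n\ge 0$, and let $$|\zeta_{jk};n\rangle=\frac{(b_1^+)^n|\zeta_{jk}\rangle}{\sqrt{2^n\,\big(\frac{n-\mathcal O_n}2\big)!\,\big(\frac p2+j\big)_{(n+\mathcal O_n)/2}}},$$ where $(a)_r=a(a+1)\cdots(a+r-1)$. Let $T_1=b_1^-b_1^+$,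 and put $T_1^{-1}v=\lambda^{-1}v$ whenever $T_1v=\lambda v$ with $\lambda\ne0$. For $\alpha\in\mathbb C$ let $\tilde\psi_{jk}(\alpha)=\sum_{n\ge0}\alpha^n(b_1^+T_1^{-1})^n|\zeta_{jk}\rangle$, let $|\psi_{jk}(\alpha)\rangle=\tilde\psi_{jk}(\alpha)/\|\tilde\psi_{jk}(\alpha)\|$ be the normalized coherent state, and for $\alpha\neq0$ let $$|\psi_{jk}(\alpha)\rangle_\pm=\frac{|\psi_{jk}(\alpha)\rangle\pm|\psi_{jk}(-\alpha)\rangle}{\big\||\psi_{jk}(\alpha)\rangle\pm|\psi_{jk}(-\alpha)\rangle\big\|}$$ be the cat states. For $x>0$ let $I_\nu(x)=\sum_{n\ge0}\frac{(x/2)^{\nu+2n}}{n!\,\Gamma(\nu+n+1)}$ and $K_\nu(x)=\int_0^\infty e^{-x\cosh t}\cosh(\nu t)\,dt$ be the modified Bessel functions. Write $\alpha=\rho e^{i\theta}$ and $d^2\alpha=\frac{\rho\,d\rho\,d\theta}{2\pi}$. Then: 1. The series for $\tilde\psi_{jk}(\alpha)$ converges for every $\alpha\in\mathbb C$, and the coherent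 states ($\alpha\in\mathbb C$) and the cat states ($\alpha\ne0$) are well-defined unit vectors of $\mathcal V_{\langle j\rangle,k}$. 2. The vectors $|\zeta_{jk};n\rangle$, $n\ge0$, form an orthonormal basis of $\mathcal V_{\langle j\rangle,k}$, and on $\mathcal V_{\langle j\rangle,k}$, with the sum in the strong sense and the integral in the weak sense (every matrix element $\langle u|\cdot|v\rangle$, $u,v\in\mathcal V_{\langle j\rangle,k}$, is absolutely integrable and has the stated integral), $$\int d^2\alpha\,\rho^2\big(I_{\frac p2+j-1}(\rho^2)+I_{\frac p2+j}(\rho^2)\big)\Big(\big(K_{\frac p2+j-1}(\rho^2)+K_{\frac p2+j}(\rho^2)\big)|\psi_{jk}(\alpha)\rangle\langle\psi_{jk}(\alpha)|$$ $$\qquad+\big(K_{\frac p2+j-1}(\rho^2)-K_{\frac p2+j}(\rho^2)\big)|\psi_{jk}(\alpha)\rangle\langle\psi_{jk}(-\alpha)|\Big)=\sum_{n=0}^\infty|\zeta_{jk};n\rangle\langle\zeta_{jk};n|=\mathbb I.$$ 3. In the same weak sense, on $\mathcal V_{\langle j\rangle,k}$, $$\int\frac{\rho\,d\rho\,d\theta}{\pi}\,\rho^2\Big(I_{\frac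 p2+j-1}(\rho^2)K_{\frac p2+j-1}(\rho^2)\,|\psi_{jk}(\alpha)\rangle_+\,{}_+\langle\psi_{jk}(\alpha)|+I_{\frac p2+j}(\rho^2)K_{\frac p2+j}(\rho^2)\,|\psi_{jk}(\alpha)\rangle_-\,{}_-\langle\psi_{jk}(\alpha)|\Big)=\mathbb I,$$ and both weights $\rho^2I_\nu(\rho^2)K_\nu(\rho^2)$, $\nu=\frac p2+j-1$ and $\nu=\frac p2+j$, are positive for all $\rho>0$. -/

import Mathlib

open MeasureTheory
open scoped ENNReal

noncomputable section

namespace Paraboson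

/-! ### The paraboson Fock space of order `p` with its Gelfand–Zetlin basis -/

/-- Gelfand–Zetlin patterns: integers with `m12 ≥ m22 ≥ 0` and `m12 ≥ m11 ≥ m22`. -/
@[ext]
structure GZ where
  m12 : ℤ
  m22 : ℤ
  m11 : ℤ
  nonneg : 0 ≤ m22
  lower : m22 ≤ m11
  upper : m11 ≤ m12

/-- Finite linear combinations of Gelfand–Zetlin vectors. -/
abbrev FinVec : Type := GZ →₀ ℂ

/-- The Hilbert space with the Gelfand–Zetlin vectors as orthonormal basis. -/
abbrev Fock : Type := lp (fun _ : GZ => ℂ) 2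

/-- The inclusion of the finite combinations in the Hilbert space. -/
def toFock : FinVec →ₗ[ℂ] Fock :=
  open Classical in
  Finsupp.linearCombination ℂ (fun m : GZ => (lp.single 2 m (1 : ℂ) : Fock))

open Classical in
/-- The basis vector `|a, b; c)`, with `a = m12`, `b = m22`, `c = m11`; it is `0` if the three
integers do not form a pattern. -/
def ket (a b c : ℤ) : FinVec :=
  if h : 0 ≤ b ∧ b ≤ c ∧ c ≤ a then Finsupp.single ⟨a, b, c, h.1, h.2.1, h.2.2⟩ 1 else 0

/-- The even function `𝓔`. -/
def evenInd (n : ℤ) : ℝ := if Even n then 1 else 0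

/-- The odd function `𝓞`. -/
def oddInd (n : ℤ) : ℝ := if Odd n then 1 else 0

def f₁ (p : ℝ) (a b : ℤ) : ℝ :=
  (-1 : ℝ) ^ b * Real.sqrt (a + 2 + evenInd a * (p - 2)) /
    Real.sqrt (a - b + 1 + oddInd (a - b))

def f₂ (p : ℝ) (a b : ℤ) : ℝ :=
  Real.sqrt (b + 1 + evenInd b * (p - 2)) / Real.sqrt (a - b + 1 - oddInd (a - b))

/-- The creation operator `b₁⁺`. -/
def bPlus (p : ℝ) : FinVec →ₗ[ℂ] FinVec :=
  Finsupp.linearCombination ℂ fun m : GZ =>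
    ((Real.sqrt (m.m11 - m.m22 + 1) * f₁ p m.m12 m.m22 : ℝ) : ℂ) •
        ket (m.m12 + 1) m.m22 (m.m11 + 1)
      - ((Real.sqrt (m.m12 - m.m11) * f₂ p m.m12 m.m22 : ℝ) : ℂ) •
        ket m.m12 (m.m22 + 1) (m.m11 + 1)

/-- The annihilation operator `b₁⁻`. -/
def bMinus (p : ℝ) : FinVec →ₗ[ℂ] FinVec :=
  Finsupp.linearCombination ℂ fun m : GZ =>
    ((Real.sqrt (m.m11 - m.m22) * f₁ p (m.m12 - 1) m.m22 : ℝ) : ℂ) •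
        ket (m.m12 - 1) m.m22 (m.m11 - 1)
      - ((Real.sqrt (m.m12 - m.m11 + 1) * f₂ p m.m12 (m.m22 - 1) : ℝ) : ℂ) •
        ket m.m12 (m.m22 - 1) (m.m11 - 1)

/-- The Cartan element `h₁`. -/
def h₁ (p : ℝ) : FinVec →ₗ[ℂ] FinVec :=
  Finsupp.linearCombination ℂ fun m : GZ =>
    ((p / 2 + m.m11 : ℝ) : ℂ) • ket m.m12 m.m22 m.m11

/-- The Cartan element `h₂`. -/
def h₂ (p : ℝ) : FinVec →ₗ[ℂ] FinVec :=
  Finsupp.linearCombination ℂ fun m : GZ =>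
    ((p / 2 + m.m12 + m.m22 - m.m11 : ℝ) : ℂ) • ket m.m12 m.m22 m.m11

/-- `ζ` is a state `|ζ_{jk}⟩`: a normalized vector of weight `(p/2 + j, p/2 + k)` annihilated
by `b₁⁻`. -/
structure IsZeroMode (p : ℝ) (j k : ℕ) (ζ : FinVec) : Prop where
  weight₁ : h₁ p ζ = ((p / 2 + j : ℝ) : ℂ) • ζ
  weight₂ : h₂ p ζ = ((p / 2 + k : ℝ) : ℂ) • ζ
  annihilated : bMinus p ζ = 0
  normalized : ‖toFock ζ‖ = 1

/-- The number state `|ζ_{jk}; n⟩`; here `n / 2 = (n - 𝓞 n) / 2` and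
`(n + 1) / 2 = (n + 𝓞 n) / 2` are integer divisions, and the last factor under the root is the
rising factorial of `p / 2 + j`. -/
def numberState (p : ℝ) (j : ℕ) (ζ : FinVec) (n : ℕ) : Fock :=
  (((Real.sqrt (2 ^ n * ((n / 2).factorial : ℝ) *
      ∏ i ∈ Finset.range ((n + 1) / 2), (p / 2 + j + i)))⁻¹ : ℝ) : ℂ) •
    toFock ((bPlus p ^ n) ζ)

/-- The (closed) subspace `𝓥` spanned by the vectors `(b₁⁺)ⁿ ζ`, `n = 0, 1, 2, …`. -/
def cyclicSubspace (p : ℝ) (ζ : FinVec) : Submodule ℂ Fock :=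
  (Submodule.span ℂ (Set.range fun n : ℕ => toFock ((bPlus p ^ n) ζ))).topologicalClosure

/-! ### Coherent states -/

/-- `T₁ = b₁⁻ b₁⁺`. -/
def T₁ (p : ℝ) : FinVec →ₗ[ℂ] FinVec := bMinus p ∘ₗ bPlus p

open Classical in
/-- `T₁⁻¹ v = c⁻¹ v` for an eigenvector `v` of `T₁` with nonzero eigenvalue `c` (on all other
vectors the value is irrelevant). -/
def T₁inv (p : ℝ) (v : FinVec) : FinVec :=
  if h : ∃ c : ℂ, c ≠ 0 ∧ T₁ p v = c • v then (h.choose)⁻¹ • v else 0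

/-- The `n`-th term `αⁿ (b₁⁺ T₁⁻¹)ⁿ ζ` of the series `χ(α) ζ`. -/
def vertexTerm (p : ℝ) (ζ : FinVec) (α : ℂ) (n : ℕ) : Fock :=
  α ^ n • toFock ((fun v => bPlus p (T₁inv p v))^[n] ζ)

/-- The unnormalized coherent state `χ(α) ζ`. -/
def cohRaw (p : ℝ) (ζ : FinVec) (α : ℂ) : Fock := ∑' n, vertexTerm p ζ α n

/-- The normalized coherent state `|ψ(α)⟩`. -/
def coh (p : ℝ) (ζ : FinVec) (α : ℂ) : Fock := ((‖cohRaw p ζ α‖⁻¹ : ℝ) : ℂ) • cohRaw p ζ α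

/-- The even cat state `|ψ(α)⟩₊`. -/
def catPlus (p : ℝ) (ζ : FinVec) (α : ℂ) : Fock :=
  ((‖coh p ζ α + coh p ζ (-α)‖⁻¹ : ℝ) : ℂ) • (coh p ζ α + coh p ζ (-α))

/-- The odd cat state `|ψ(α)⟩₋` (meaningful for `α ≠ 0`). -/
def catMinus (p : ℝ) (ζ : FinVec) (α : ℂ) : Fock :=
  ((‖coh p ζ α - coh p ζ (-α)‖⁻¹ : ℝ) : ℂ) • (coh p ζ α - coh p ζ (-α))

/-- The operator `|x⟩⟨y|`. -/
def ketBra (x y : Fock) : Fock →L[ℂ] Fock := InnerProductSpace.rankOne ℂ x y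

/-! ### Modified Bessel functions at positive real argument -/

/-- Modified Bessel function of the first kind, by its power series (`x > 0`). -/
def besselI (ν x : ℝ) : ℝ :=
  ∑' n : ℕ, (x / 2) ^ (ν + 2 * (n : ℝ)) / ((n.factorial : ℝ) * Real.Gamma (ν + n + 1))

/-- Modified Bessel function of the second kind (`x > 0`, any real order), by its standard
integral representation `∫₀^∞ exp(-x cosh t) cosh(ν t) dt`. -/
def besselK (ν x : ℝ) : ℝ :=
  ∫ t in Set.Ioi (0 : ℝ), Real.exp (-(x * Real.cosh t)) * Real.cosh (ν * t)

/-! ### Operator-valued integrals over the complex plane -/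

/-- The measure `d²α = ρ dρ dθ / (2π)` on the complex plane. -/
def d2α : Measure ℂ := ENNReal.ofReal (1 / (2 * Real.pi)) • (volume : Measure ℂ)

/-- `∫ A(α) dμ(α)` is the identity operator on the subspace `V`, the integral being understood
in the weak sense: all matrix elements are absolutely integrable, with the right value. -/
def IntegralIsIdentityOn (V : Submodule ℂ Fock) (μ : Measure ℂ) (A : ℂ → Fock →L[ℂ] Fock) :
    Prop :=
  ∀ u ∈ V, ∀ v ∈ V, Integrable (fun α => inner ℂ u (A α v)) μ ∧
    ∫ α, inner ℂ u (A α v) ∂μ = inner ℂ u v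

end Paraboson

end

noncomputable section

namespace Paraboson

/-! ### Operators on the Gelfand–Zetlin basis -/

/-! The operators `bPlus` and `bMinus` are adjoint (`inner_bPlus`) and satisfy `anticomm` and
`h₁_bPlus`, so they act on the vectors (b₁⁺)ⁿζ as a lowest weight representation of osp(1|2).
Induction from b₁⁻ζ = 0 gives b₁⁻b₁⁺(b₁⁺)ⁿζ = λₙ₊₁(b₁⁺)ⁿζ with λ = `ladder`. Hence these vectors are
orthogonal with squared norms Nₙ = λ₁⋯λₙ = `normSq`, and (b₁⁺T₁⁻¹)ⁿζ = Nₙ⁻¹(b₁⁺)ⁿζ. The unnormalized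
coherent state therefore has coordinates αⁿ/√Nₙ in the number states.

Existence and uniqueness of ζ come from a two-term recursion: the weights leave one coefficient for
each value s = 0, …, j of m₂₂, and b₁⁻ζ = 0 expresses the coefficient at s + 1 through that at s,
with a nonzero divisor because j ≤ k.

Put ν = p/2 + j - 1 (`order`) and r = |α|². Up to one common factor `besselRatio`, the squared norms
of the even and odd parts of the coherent state are I_ν(r) and I_{ν+1}(r). The I-factors in the
weights thus cancel the normalizations. After splitting ψ(±α) into even and odd parts, both
decompositions reduce to `integral_two_weights`, where K_ν is paired with the even part and K_{ν+1}
with the odd part. Rotation invariance removes the terms with different powers of α. The diagonal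
terms form a moment problem solved by the Mellin transform of K_μ (`lintegral_besselK_moment`): the
moments of index 2m for K_ν and 2m + 1 for K_{ν+1} are exactly N_{2m} and N_{2m+1}.

Termwise integration for arbitrary u, v is an L² argument (`hasSum_integral_inner`): the component
functions are orthogonal in L²(d²α) with bounded norms, so expansions with square summable
coefficients converge there. The bound must also cover moments of the wrong parity
(`moment_add_one_le`), where ν > -1/2, that is p > 1, is used. -/

lemma ket_self (m : GZ) : ket m.m12 m.m22 m.m11 = Finsupp.single m 1 := by
  have h : 0 ≤ m.m22 ∧ m.m22 ≤ m.m11 ∧ m.m11 ≤ m.m12 := ⟨m.nonneg, m.lower, m.upper⟩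
  simp [ket, h]

open Classical in
lemma ket_apply (a b c : ℤ) (m : GZ) :
    ket a b c m = if m.m12 = a ∧ m.m22 = b ∧ m.m11 = c then 1 else 0 := by
  by_cases h : 0 ≤ b ∧ b ≤ c ∧ c ≤ a
  · simp only [ket, h, and_self, dite_true]
    rw [Finsupp.single_apply]
    congr 1
    simp only [GZ.ext_iff, eq_comm]
  · have h' : ¬ (m.m12 = a ∧ m.m22 = b ∧ m.m11 = c) := by
      rintro ⟨rfl, rfl, rfl⟩
      exact h ⟨m.nonneg, m.lower, m.upper⟩
    simp [ket, h, h']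

lemma bPlus_single (p : ℝ) (m : GZ) : bPlus p (Finsupp.single m 1) =
    ((Real.sqrt (m.m11 - m.m22 + 1) * f₁ p m.m12 m.m22 : ℝ) : ℂ) •
        ket (m.m12 + 1) m.m22 (m.m11 + 1)
      - ((Real.sqrt (m.m12 - m.m11) * f₂ p m.m12 m.m22 : ℝ) : ℂ) •
        ket m.m12 (m.m22 + 1) (m.m11 + 1) := by
  simp [bPlus, Finsupp.linearCombination_single]

lemma bMinus_single (p : ℝ) (m : GZ) : bMinus p (Finsupp.single m 1) =
    ((Real.sqrt (m.m11 - m.m22) * f₁ p (m.m12 - 1) m.m22 : ℝ) : ℂ) •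
        ket (m.m12 - 1) m.m22 (m.m11 - 1)
      - ((Real.sqrt (m.m12 - m.m11 + 1) * f₂ p m.m12 (m.m22 - 1) : ℝ) : ℂ) •
        ket m.m12 (m.m22 - 1) (m.m11 - 1) := by
  simp [bMinus, Finsupp.linearCombination_single]

lemma bPlus_ket (p : ℝ) {a b c : ℤ} (h : 0 ≤ b ∧ b ≤ c ∧ c ≤ a) : bPlus p (ket a b c) =
    ((Real.sqrt (c - b + 1) * f₁ p a b : ℝ) : ℂ) • ket (a + 1) b (c + 1)
      - ((Real.sqrt (a - c) * f₂ p a b : ℝ) : ℂ) • ket a (b + 1) (c + 1) := by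
  have := bPlus_single p ⟨a, b, c, h.1, h.2.1, h.2.2⟩
  rwa [← ket_self] at this

lemma bMinus_ket (p : ℝ) {a b c : ℤ} (h : 0 ≤ b ∧ b ≤ c ∧ c ≤ a) : bMinus p (ket a b c) =
    ((Real.sqrt (c - b) * f₁ p (a - 1) b : ℝ) : ℂ) • ket (a - 1) b (c - 1)
      - ((Real.sqrt (a - c + 1) * f₂ p a (b - 1) : ℝ) : ℂ) • ket a (b - 1) (c - 1) := by
  have := bMinus_single p ⟨a, b, c, h.1, h.2.1, h.2.2⟩
  rwa [← ket_self] at this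

lemma h₁_ket (p : ℝ) (a b c : ℤ) :
    h₁ p (ket a b c) = ((p / 2 + c : ℝ) : ℂ) • ket a b c := by
  by_cases h : 0 ≤ b ∧ b ≤ c ∧ c ≤ a
  · simp [ket, h, h₁, Finsupp.linearCombination_single]
  · simp [ket, h]

lemma h₂_ket (p : ℝ) (a b c : ℤ) :
    h₂ p (ket a b c) = ((p / 2 + a + b - c : ℝ) : ℂ) • ket a b c := by
  by_cases h : 0 ≤ b ∧ b ≤ c ∧ c ≤ a
  · simp [ket, h, h₂, Finsupp.linearCombination_single]
  · simp [ket, h]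

/-! ### Parity and the reduced matrix elements -/

lemma evenInd_of_even {n : ℤ} (h : Even n) : evenInd n = 1 := by simp [evenInd, h]
lemma evenInd_of_odd {n : ℤ} (h : Odd n) : evenInd n = 0 := by
  simp [evenInd, Int.not_even_iff_odd.2 h]
lemma oddInd_of_odd {n : ℤ} (h : Odd n) : oddInd n = 1 := by simp [oddInd, h]
lemma oddInd_of_even {n : ℤ} (h : Even n) : oddInd n = 0 := by
  simp [oddInd, Int.not_odd_iff_even.2 h]

/-- Numerator of the reduced matrix elements. -/
def numer (p : ℝ) (n : ℤ) : ℝ := n + 1 + evenInd n * (p - 2)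

lemma numer_even (p : ℝ) {n : ℤ} (h : Even n) : numer p n = n + p - 1 := by
  rw [numer, evenInd_of_even h]; ring

lemma numer_odd (p : ℝ) {n : ℤ} (h : Odd n) : numer p n = n + 1 := by
  rw [numer, evenInd_of_odd h]; ring

lemma numer_pos {p : ℝ} (hp : 1 < p) {n : ℤ} (hn : 0 ≤ n) : 0 < numer p n := by
  have : (0 : ℝ) ≤ n := by exact_mod_cast hn
  rcases Int.even_or_odd n with h | h
  · rw [numer_even p h]; linarith
  · rw [numer_odd p h]; linarith

lemma numer_nonneg {p : ℝ} (hp : 1 < p) {n : ℤ} (hn : -1 ≤ n) : 0 ≤ numer p n := by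
  rcases hn.eq_or_lt with rfl | hn
  · rw [numer_odd p (by decide)]; norm_num
  · exact (numer_pos hp (by omega)).le

/-- The ranges reach one step beyond the patterns, since `f_sq_sum` evaluates it at (a - 1, b) even
when a = b or a = 0. -/
lemma f₁_sq {p : ℝ} (hp : 1 < p) {a b : ℤ} (ha : -1 ≤ a) (hab : b ≤ a + 1) :
    f₁ p a b ^ 2 = (numer p a + 1) / (a - b + 1 + oddInd (a - b)) := by
  have h1 := numer_nonneg hp ha
  have h2 : (b : ℝ) ≤ a + 1 := by exact_mod_cast hab
  have h3 : 0 ≤ oddInd (a - b) := by unfold oddInd; split_ifs <;> norm_num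
  have h4 : ((-1 : ℝ) ^ b) ^ 2 = 1 := by
    rw [← zpow_natCast, ← zpow_mul, mul_comm, zpow_mul]; simp
  rw [f₁, div_pow, mul_pow, h4, Real.sq_sqrt, Real.sq_sqrt (by linarith), one_mul, numer]
  · ring
  · rw [numer] at h1; linarith

lemma f₂_sq {p : ℝ} (hp : 1 < p) {a b : ℤ} (hb : -1 ≤ b) (hab : b ≤ a) :
    f₂ p a b ^ 2 = numer p b / (a - b + 1 - oddInd (a - b)) := by
  have h1 := numer_nonneg hp hb
  have h2 : (b : ℝ) ≤ a := by exact_mod_cast hab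
  have h3 : oddInd (a - b) ≤ 1 := by unfold oddInd; split_ifs <;> norm_num
  rw [f₂, div_pow, Real.sq_sqrt, Real.sq_sqrt (by linarith), numer]
  rw [numer] at h1; linarith

/-- An odd difference a - b is at least 1, so the denominator a - b + 1 - 𝓞 stays positive. This
makes the recursion for the zero mode solvable. -/
lemma f₂_pos {p : ℝ} (hp : 1 < p) {a b : ℤ} (hb : 0 ≤ b) (hab : b ≤ a) : 0 < f₂ p a b := by
  have h1 := numer_pos hp hb
  have h2 : (b : ℝ) ≤ a := by exact_mod_cast hab
  have h3 : 0 < (a : ℝ) - b + 1 - oddInd (a - b) := by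
    rcases Int.even_or_odd (a - b) with h | h
    · rw [oddInd_of_even h]; linarith
    · have h4 : b + 1 ≤ a := by
        rcases hab.eq_or_lt with rfl | h5
        · simp at h
        · omega
      have h5 : (b : ℝ) + 1 ≤ a := by exact_mod_cast h4
      rw [oddInd_of_odd h]; linarith
  rw [numer] at h1
  exact div_pos (Real.sqrt_pos.2 h1) (Real.sqrt_pos.2 h3)

/-- Cancellation of the off-diagonal matrix elements of `{b₁⁻, b₁⁺}`. -/
lemma f₁_mul_f₂_add {a b : ℤ} (p : ℝ) (hab : b ≤ a) :
    f₁ p a b * f₂ p (a + 1) (b - 1) + f₂ p a (b - 1) * f₁ p a (b - 1) = 0 := by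
  have h2 : (b : ℝ) ≤ a := by exact_mod_cast hab
  have hs : (-1 : ℝ) ^ b = - (-1 : ℝ) ^ (b - 1) := by
    rw [zpow_sub_one₀ (by norm_num)]; ring
  -- With d = a - b, both products are √(d+1)·√(d+3) for even d and √(d+2)·√(d+2) for odd d. The
  -- numerators agree as well, so the sign (-1)ᵇ produces the cancellation.
  have key : Real.sqrt (a - b + 1 + oddInd (a - b)) *
        Real.sqrt ((a + 1 : ℤ) - (b - 1 : ℤ) + 1 - oddInd (a + 1 - (b - 1))) =
      Real.sqrt (a - (b - 1 : ℤ) + 1 - oddInd (a - (b - 1))) *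
        Real.sqrt (a - (b - 1 : ℤ) + 1 + oddInd (a - (b - 1))) := by
    have e1 : a + 1 - (b - 1) = (a - b) + 2 := by ring
    have e2 : a - (b - 1) = (a - b) + 1 := by ring
    rw [e1, e2]
    rcases Int.even_or_odd (a - b) with h | h
    · rw [oddInd_of_even h, oddInd_of_odd h.add_one, oddInd_of_even (h.add (by decide))]
      push_cast
      ring_nf
    · rw [oddInd_of_odd h, oddInd_of_even h.add_one, oddInd_of_odd (h.add_even (by decide))]
      push_cast
      ring_nf
  unfold f₁ f₂
  rw [hs, div_mul_div_comm, key, div_mul_div_comm]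
  ring

/-- The diagonal matrix elements of `{b₁⁻, b₁⁺}`. -/
lemma f_sq_sum {p : ℝ} (hp : 1 < p) {a b : ℤ} (c : ℝ) (hb : 0 ≤ b) (hab : b ≤ a) :
    (c - b + 1) * f₁ p a b ^ 2 + (a - c) * f₂ p a b ^ 2 + (c - b) * f₁ p (a - 1) b ^ 2
      + (a - c + 1) * f₂ p a (b - 1) ^ 2 = 2 * (p / 2 + c) := by
  have h2 : (b : ℝ) ≤ a := by exact_mod_cast hab
  rw [f₁_sq hp (by omega) (by omega), f₁_sq hp (by omega) (by omega),
    f₂_sq hp (by omega) (by omega), f₂_sq hp (by omega) (by omega)]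
  have e1 : a - 1 - b = a - b - 1 := by ring
  have e2 : a - (b - 1) = a - b + 1 := by ring
  rw [e1, e2]
  -- For odd a - b a denominator a - b occurs; oddness excludes a = b.
  have hodd : Odd (a - b) → (b : ℝ) + 1 ≤ a := by
    intro h
    rcases hab.eq_or_lt with rfl | h5
    · simp at h
    · exact_mod_cast h5
  rcases Int.even_or_odd a with ha | ha <;> rcases Int.even_or_odd b with hb' | hb'
  · have hd : Even (a - b) := ha.sub hb'
    rw [numer_even p ha, numer_odd p (ha.sub_odd odd_one), numer_even p hb', numer_odd p (hb'.sub_odd odd_one),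
      oddInd_of_even hd, oddInd_of_odd hd.add_one, oddInd_of_odd (hd.sub_odd odd_one)]
    have : (a : ℝ) - b + 1 ≠ 0 := by linarith
    push_cast
    have e3 : (a : ℝ) - (b - 1) + 1 - 1 = a - b + 1 := by ring
    have e4 : (a : ℝ) - 1 - b + 1 + 1 = a - b + 1 := by ring
    rw [e3, e4, add_zero, sub_zero]
    field_simp
    ring
  · have hd := ha.sub_odd hb'
    have := hodd hd
    rw [numer_even p ha, numer_odd p (ha.sub_odd odd_one), numer_odd p hb', numer_even p (hb'.sub_odd odd_one),
      oddInd_of_odd hd, oddInd_of_even hd.add_one, oddInd_of_even (hd.sub_odd odd_one)]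
    push_cast
    have e3 : (a : ℝ) - (b - 1) + 1 - 0 = a - b + 2 := by ring
    have e4 : (a : ℝ) - 1 - b + 1 + 0 = a - b := by ring
    have e5 : (a : ℝ) - b + 1 + 1 = a - b + 2 := by ring
    have e6 : (a : ℝ) - b + 1 - 1 = a - b := by ring
    rw [e3, e4, e5, e6]
    have h3 : (a : ℝ) - b ≠ 0 := by linarith
    have h4 : (a : ℝ) - b + 2 ≠ 0 := by linarith
    field_simp
    ring
  · have hd : Odd (a - b) := ha.sub_even hb'
    have := hodd hd
    rw [numer_odd p ha, numer_even p (ha.sub_odd odd_one), numer_even p hb', numer_odd p (hb'.sub_odd odd_one),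
      oddInd_of_odd hd, oddInd_of_even hd.add_one, oddInd_of_even (hd.sub_odd odd_one)]
    push_cast
    have e3 : (a : ℝ) - (b - 1) + 1 - 0 = a - b + 2 := by ring
    have e4 : (a : ℝ) - 1 - b + 1 + 0 = a - b := by ring
    have e5 : (a : ℝ) - b + 1 + 1 = a - b + 2 := by ring
    have e6 : (a : ℝ) - b + 1 - 1 = a - b := by ring
    rw [e3, e4, e5, e6]
    have h3 : (a : ℝ) - b ≠ 0 := by linarith
    have h4 : (a : ℝ) - b + 2 ≠ 0 := by linarith
    field_simp
    ring
  · have hd := ha.sub_odd hb'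
    rw [numer_odd p ha, numer_even p (ha.sub_odd odd_one), numer_odd p hb', numer_even p (hb'.sub_odd odd_one),
      oddInd_of_even hd, oddInd_of_odd hd.add_one, oddInd_of_odd (hd.sub_odd odd_one)]
    have : (a : ℝ) - b + 1 ≠ 0 := by linarith
    push_cast
    have e3 : (a : ℝ) - (b - 1) + 1 - 1 = a - b + 1 := by ring
    have e4 : (a : ℝ) - 1 - b + 1 + 1 = a - b + 1 := by ring
    rw [e3, e4, add_zero, sub_zero]
    field_simp
    ring

/-- As -1 is odd, the numerator b + 1 + 𝓔_b(p - 2) is 0 there. So the lowering of m₂₂ = 0 is killed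
by its own coefficient. -/
lemma f₂_neg_one (p : ℝ) (a : ℤ) : f₂ p a (-1) = 0 := by
  have : evenInd (-1) = 0 := evenInd_of_odd (by decide)
  simp [f₂, this]

/-- The triple relation `{b₁⁻, b₁⁺} = 2 h₁`. -/
lemma anticomm {p : ℝ} (hp : 1 < p) (v : FinVec) :
    bMinus p (bPlus p v) + bPlus p (bMinus p v) = (2 : ℂ) • h₁ p v := by
  suffices H : bMinus p ∘ₗ bPlus p + bPlus p ∘ₗ bMinus p = (2 : ℂ) • h₁ p from
    LinearMap.congr_fun H v
  refine Finsupp.lhom_ext' fun m => LinearMap.ext_ring ?_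
  simp only [LinearMap.coe_comp, Function.comp_apply, LinearMap.add_apply, LinearMap.smul_apply,
    Finsupp.lsingle_apply]
  rw [← ket_self]
  obtain ⟨a, b, c, hb, hbc, hca⟩ := m
  dsimp only
  have hb' : (0 : ℝ) ≤ b := by exact_mod_cast hb
  have hbc' : (b : ℝ) ≤ c := by exact_mod_cast hbc
  have hca' : (c : ℝ) ≤ a := by exact_mod_cast hca
  have A1 := bMinus_ket p (a := a + 1) (b := b) (c := c + 1) (by omega)
  -- In `A2`, `A3` and `A4` the scalar stays in front: whenever the ket is not a pattern (c = a, c =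
  -- b, b = 0 respectively) that scalar vanishes, so the formula for patterns can be used without
  -- exception.
  have A2 : ((Real.sqrt (a - c) * f₂ p a b : ℝ) : ℂ) • bMinus p (ket a (b + 1) (c + 1)) =
      ((Real.sqrt (a - c) * f₂ p a b : ℝ) : ℂ) •
        (((Real.sqrt (c - b) * f₁ p (a - 1) (b + 1) : ℝ) : ℂ) • ket (a - 1) (b + 1) c
      - ((Real.sqrt (a - c) * f₂ p a b : ℝ) : ℂ) • ket a b c) := by
    rcases hca.eq_or_lt with rfl | h
    · simp
    · rw [bMinus_ket p (by omega)]
      congr 3 <;> push_cast <;> ring_nf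
  have A3 : ((Real.sqrt (c - b) * f₁ p (a - 1) b : ℝ) : ℂ) • bPlus p (ket (a - 1) b (c - 1)) =
      ((Real.sqrt (c - b) * f₁ p (a - 1) b : ℝ) : ℂ) •
        (((Real.sqrt (c - b) * f₁ p (a - 1) b : ℝ) : ℂ) • ket a b c
      - ((Real.sqrt (a - c) * f₂ p (a - 1) b : ℝ) : ℂ) • ket (a - 1) (b + 1) c) := by
    rcases hbc.eq_or_lt with rfl | h
    · simp
    · rw [bPlus_ket p (by omega)]
      congr 3 <;> push_cast <;> ring_nf
  have A4 : ((Real.sqrt (a - c + 1) * f₂ p a (b - 1) : ℝ) : ℂ) •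
        bPlus p (ket a (b - 1) (c - 1)) =
      ((Real.sqrt (a - c + 1) * f₂ p a (b - 1) : ℝ) : ℂ) •
        (((Real.sqrt (c - b + 1) * f₁ p a (b - 1) : ℝ) : ℂ) • ket (a + 1) (b - 1) c
      - ((Real.sqrt (a - c + 1) * f₂ p a (b - 1) : ℝ) : ℂ) • ket a b c) := by
    rcases hb.eq_or_lt with rfl | h
    · simp [f₂_neg_one]
    · rw [bPlus_ket p (by omega)]
      congr 3 <;> push_cast <;> ring_nf
  rw [bPlus_ket p ⟨hb, hbc, hca⟩, bMinus_ket p ⟨hb, hbc, hca⟩, map_sub, map_sub, map_smul,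
    map_smul, map_smul, map_smul, A1, A2, A3, A4, h₁_ket]
  have e1 : (Real.sqrt (((c + 1 : ℤ) : ℝ) - b)) = Real.sqrt (c - b + 1) := by
    push_cast; ring_nf
  have e2 : (Real.sqrt (((a + 1 : ℤ) : ℝ) - (c + 1 : ℤ) + 1)) = Real.sqrt (a - c + 1) := by
    push_cast; ring_nf
  rw [e1, e2]
  simp only [add_sub_cancel_right]
  have C1 := f₁_mul_f₂_add p (hbc.trans hca)
  have C2 : Real.sqrt (a - c) * Real.sqrt (c - b) *
      (f₁ p (a - 1) (b + 1) * f₂ p a b + f₂ p (a - 1) b * f₁ p (a - 1) b) = 0 := by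
    rcases hca.eq_or_lt with rfl | h
    · simp
    rcases hbc.eq_or_lt with rfl | h'
    · simp
    have := f₁_mul_f₂_add p (a := a - 1) (b := b + 1) (by omega)
    simp only [add_sub_cancel_right, sub_add_cancel] at this
    rw [this, mul_zero]
  have D := f_sq_sum hp (c : ℝ) hb (hbc.trans hca)
  have s1 := Real.mul_self_sqrt (show (0 : ℝ) ≤ c - b + 1 by linarith)
  have s2 := Real.mul_self_sqrt (show (0 : ℝ) ≤ c - b by linarith)
  have s3 := Real.mul_self_sqrt (show (0 : ℝ) ≤ a - c by linarith)
  have s4 := Real.mul_self_sqrt (show (0 : ℝ) ≤ a - c + 1 by linarith)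
  set S1 := Real.sqrt ((c : ℝ) - b + 1)
  set S2 := Real.sqrt ((c : ℝ) - b)
  set S3 := Real.sqrt ((a : ℝ) - c)
  set S4 := Real.sqrt ((a : ℝ) - c + 1)
  have E1 : S1 * f₁ p a b * (S4 * f₂ p (a + 1) (b - 1)) +
      S4 * f₂ p a (b - 1) * (S1 * f₁ p a (b - 1)) = 0 := by linear_combination S1 * S4 * C1
  have E2 : S3 * f₂ p a b * (S2 * f₁ p (a - 1) (b + 1)) +
      S2 * f₁ p (a - 1) b * (S3 * f₂ p (a - 1) b) = 0 := by linear_combination C2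
  have E3 : S1 * f₁ p a b * (S1 * f₁ p a b) + S3 * f₂ p a b * (S3 * f₂ p a b) +
      S2 * f₁ p (a - 1) b * (S2 * f₁ p (a - 1) b) +
      S4 * f₂ p a (b - 1) * (S4 * f₂ p a (b - 1)) = 2 * (p / 2 + c) := by
    linear_combination D + f₁ p a b ^ 2 * s1 + f₁ p (a - 1) b ^ 2 * s2 + f₂ p a b ^ 2 * s3 +
      f₂ p a (b - 1) ^ 2 * s4
  have E1' := congrArg (fun x : ℝ => (x : ℂ)) E1
  have E2' := congrArg (fun x : ℝ => (x : ℂ)) E2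
  have E3' := congrArg (fun x : ℝ => (x : ℂ)) E3
  push_cast at E1' E2' E3' ⊢
  linear_combination (norm := module) (-E1') • ket (a + 1) (b - 1) c - E2' • ket (a - 1) (b + 1) c
    + E3' • ket a b c

/-- `[h₁, b₁⁺] = b₁⁺`. -/
lemma h₁_bPlus (p : ℝ) (v : FinVec) : h₁ p (bPlus p v) = bPlus p (h₁ p v) + bPlus p v := by
  suffices H : h₁ p ∘ₗ bPlus p = bPlus p ∘ₗ h₁ p + bPlus p from LinearMap.congr_fun H v
  refine Finsupp.lhom_ext' fun m => LinearMap.ext_ring ?_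
  simp only [LinearMap.coe_comp, Function.comp_apply, LinearMap.add_apply, Finsupp.lsingle_apply]
  rw [← ket_self, h₁_ket, map_smul, bPlus_ket p ⟨m.nonneg, m.lower, m.upper⟩, map_sub, map_smul,
    map_smul, h₁_ket, h₁_ket]
  push_cast
  module

/-! ### Coefficients as inner products, and the adjoint relation -/

open Classical in
lemma toFock_single (m : GZ) :
    toFock (Finsupp.single m 1) = (lp.single 2 m (1 : ℂ) : Fock) := by
  simp [toFock, Finsupp.linearCombination_single]

lemma inner_single_toFock (m : GZ) (v : FinVec) :
    inner ℂ (toFock (Finsupp.single m 1)) (toFock v) = v m := by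
  classical
  induction v using Finsupp.induction_linear with
  | zero => simp
  | add f g hf hg => simp [hf, hg]
  | single n x =>
    have : Finsupp.single n x = x • Finsupp.single n (1 : ℂ) := by simp
    rw [this, map_smul, inner_smul_right, toFock_single, toFock_single, lp.inner_single_left]
    by_cases h : n = m
    · subst h; simp
    · simp [Ne.symm h]

lemma inner_toFock_single (m : GZ) (v : FinVec) :
    inner ℂ (toFock v) (toFock (Finsupp.single m 1)) = (starRingEnd ℂ) (v m) := by
  rw [← inner_conj_symm, inner_single_toFock]

/-- `b₁⁻` is the adjoint of `b₁⁺`. -/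
lemma inner_bPlus (p : ℝ) (u v : FinVec) :
    inner ℂ (toFock (bPlus p u)) (toFock v) = inner ℂ (toFock u) (toFock (bMinus p v)) := by
  -- The two matrices are real and transposes of one another; sesquilinearity does the rest.
  have key : ∀ m n : GZ, (starRingEnd ℂ) (bPlus p (Finsupp.single m 1) n) =
      bMinus p (Finsupp.single n 1) m := by
    classical
    intro m n
    rw [bPlus_single, bMinus_single]
    simp only [Finsupp.sub_apply, Finsupp.smul_apply, ket_apply, smul_eq_mul, map_sub,
      Complex.conj_ofReal, mul_ite, mul_one, mul_zero, apply_ite (starRingEnd ℂ), map_zero]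
    congr 1
    · by_cases h : n.m12 = m.m12 + 1 ∧ n.m22 = m.m22 ∧ n.m11 = m.m11 + 1
      · obtain ⟨h1, h2, h3⟩ := h
        simp [h1, h2, h3]
        left; ring_nf
      · rw [if_neg h, if_neg (by omega)]
    · by_cases h : n.m12 = m.m12 ∧ n.m22 = m.m22 + 1 ∧ n.m11 = m.m11 + 1
      · obtain ⟨h1, h2, h3⟩ := h
        simp [h1, h2, h3]
        left; ring_nf
      · rw [if_neg h, if_neg (by omega)]
  have smul_one : ∀ (m : GZ) (x : ℂ), Finsupp.single m x = x • Finsupp.single m (1 : ℂ) := by simp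
  induction u using Finsupp.induction_linear with
  | zero => simp
  | add f g hf hg => simp [hf, hg]
  | single m x =>
    induction v using Finsupp.induction_linear with
    | zero => simp
    | add f g hf hg => simp [hf, hg]
    | single n y =>
      rw [smul_one m, smul_one n]
      simp only [map_smul, inner_smul_left, inner_smul_right]
      rw [inner_toFock_single, inner_single_toFock, key]

/-! ### The zero modes of `b₁⁻` -/

lemma h₁_apply (p : ℝ) (v : FinVec) (m : GZ) : h₁ p v m = ((p / 2 + m.m11 : ℝ) : ℂ) * v m := by
  classical
  induction v using Finsupp.induction_linear with
  | zero => simp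
  | add f g hf hg => simp [hf, hg, mul_add]
  | single n x =>
    have : Finsupp.single n x = x • Finsupp.single n (1 : ℂ) := by simp
    rw [this, map_smul, ← ket_self n, h₁_ket, ket_self]
    by_cases h : n = m
    · subst h
      simp only [Finsupp.smul_apply, Finsupp.single_eq_same, smul_eq_mul]
      ring
    · simp [h]

lemma h₂_apply (p : ℝ) (v : FinVec) (m : GZ) :
    h₂ p v m = ((p / 2 + m.m12 + m.m22 - m.m11 : ℝ) : ℂ) * v m := by
  classical
  induction v using Finsupp.induction_linear with
  | zero => simp
  | add f g hf hg => simp [hf, hg, mul_add]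
  | single n x =>
    have : Finsupp.single n x = x • Finsupp.single n (1 : ℂ) := by simp
    rw [this, map_smul, ← ket_self n, h₂_ket, ket_self]
    by_cases h : n = m
    · subst h; simp [mul_comm]
    · simp [h]

/-- The coefficient of `|a, b; c)`, zero if this is not a pattern. -/
def coefAt (v : FinVec) (a b c : ℤ) : ℂ := inner ℂ (toFock (ket a b c)) (toFock v)

lemma coefAt_eq (v : FinVec) {a b c : ℤ} (h : 0 ≤ b ∧ b ≤ c ∧ c ≤ a) :
    coefAt v a b c = v ⟨a, b, c, h.1, h.2.1, h.2.2⟩ := by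
  rw [← inner_single_toFock, ← ket_self, coefAt]

/-- By adjointness the coefficient is the inner product of b₁⁺|m) with v. Only the two patterns
reached from m by b₁⁺ contribute, which turns b₁⁻v = 0 into a two-term recursion. -/
lemma bMinus_apply (p : ℝ) (v : FinVec) (m : GZ) : bMinus p v m =
    ((Real.sqrt (m.m11 - m.m22 + 1) * f₁ p m.m12 m.m22 : ℝ) : ℂ) *
        coefAt v (m.m12 + 1) m.m22 (m.m11 + 1)
      - ((Real.sqrt (m.m12 - m.m11) * f₂ p m.m12 m.m22 : ℝ) : ℂ) *
        coefAt v m.m12 (m.m22 + 1) (m.m11 + 1) := by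
  rw [← inner_single_toFock, ← inner_bPlus, bPlus_single, map_sub, map_smul, map_smul,
    inner_sub_left, inner_smul_left, inner_smul_left, Complex.conj_ofReal, Complex.conj_ofReal]
  rfl

/-- The coefficients of the (unnormalized) zero mode. -/
def zeroCoef (p : ℝ) (j k : ℕ) : ℕ → ℝ
  | 0 => 1
  | s + 1 => Real.sqrt (j - s) * f₁ p (j + k - 1 - s) s /
      (Real.sqrt (k - s) * f₂ p (j + k - 1 - s) s) * zeroCoef p j k s

/-- The (unnormalized) zero mode of weight `(p/2 + j, p/2 + k)`. -/
def zeroVec (p : ℝ) (j k : ℕ) : FinVec :=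
  ∑ s ∈ Finset.range (j + 1), ((zeroCoef p j k s : ℝ) : ℂ) • ket (j + k - s) s j

lemma zeroVec_apply (p : ℝ) (j k : ℕ) (m : GZ) : zeroVec p j k m =
    if m.m11 = j ∧ m.m12 + m.m22 = j + k then ((zeroCoef p j k m.m22.toNat : ℝ) : ℂ) else 0 := by
  obtain ⟨a, b, c, hb, hbc, hca⟩ := m
  lift b to ℕ using hb
  simp only [zeroVec, Finsupp.finsetSum_apply, Finsupp.smul_apply, ket_apply, smul_eq_mul,
    mul_ite, mul_one, mul_zero]
  split_ifs with h
  · rw [Finset.sum_eq_single b]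
    · rw [if_pos (by omega)]; simp
    · intro s _ hs
      rw [if_neg (by omega)]
    · intro hs
      simp only [Finset.mem_range] at hs
      omega
  · refine Finset.sum_eq_zero fun s _ => if_neg ?_
    omega

lemma weight_zeroVec₁ (p : ℝ) (j k : ℕ) :
    h₁ p (zeroVec p j k) = ((p / 2 + j : ℝ) : ℂ) • zeroVec p j k := by
  ext m
  rw [h₁_apply, Finsupp.smul_apply, zeroVec_apply]
  split_ifs with h
  · rw [h.1]; simp
  · simp

lemma weight_zeroVec₂ (p : ℝ) (j k : ℕ) :
    h₂ p (zeroVec p j k) = ((p / 2 + k : ℝ) : ℂ) • zeroVec p j k := by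
  ext m
  rw [h₂_apply, Finsupp.smul_apply, zeroVec_apply]
  split_ifs with h
  · have h2 : (m.m12 : ℝ) + m.m22 = j + k := by exact_mod_cast h.2
    have h1 : (m.m11 : ℝ) = j := by exact_mod_cast h.1
    have : p / 2 + (m.m12 : ℝ) + m.m22 - m.m11 = p / 2 + k := by linarith
    rw [this, smul_eq_mul]
  · simp

lemma zeroCoef_denom_pos {p : ℝ} (hp : 1 < p) {j k s : ℕ} (hjk : j ≤ k) (hs : s < j) :
    0 < Real.sqrt ((k : ℝ) - s) * f₂ p (j + k - 1 - s) s := by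
  have : (s : ℝ) < k := by exact_mod_cast hs.trans_le hjk
  exact mul_pos (Real.sqrt_pos.2 (by linarith)) (f₂_pos hp (by omega) (by omega))

lemma bMinus_zeroVec {p : ℝ} (hp : 1 < p) {j k : ℕ} (hjk : j ≤ k) :
    bMinus p (zeroVec p j k) = 0 := by
  ext m
  rw [bMinus_apply, Finsupp.zero_apply]
  obtain ⟨a, b, c, hb, hbc, hca⟩ := m
  dsimp only
  lift b to ℕ using hb
  have e1 := coefAt_eq (zeroVec p j k) (a := a + 1) (b := b) (c := c + 1) (by omega)
  rw [zeroVec_apply] at e1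
  dsimp only at e1
  by_cases h : c + 1 = j ∧ a + b + 1 = j + k
  · have e2 := coefAt_eq (zeroVec p j k) (a := a) (b := b + 1) (c := c + 1) (by omega)
    rw [zeroVec_apply] at e2
    dsimp only at e2
    rw [if_pos (by omega)] at e1 e2
    rw [e1, e2]
    have t2 : ((b : ℤ) + 1).toNat = b + 1 := by omega
    rw [Int.toNat_natCast, t2, zeroCoef]
    obtain rfl : a = j + k - 1 - b := by omega
    obtain rfl : c = j - 1 := by omega
    have hpos := zeroCoef_denom_pos hp hjk (show b < j by omega)
    have r1 : ((((j : ℤ) - 1 : ℤ) : ℝ) - ((b : ℤ) : ℝ) + 1) = j - b := by push_cast; ring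
    have r2 : ((((j : ℤ) + k - 1 - b : ℤ) : ℝ) - (((j : ℤ) - 1 : ℤ) : ℝ)) = k - b := by
      push_cast; ring
    rw [r1, r2, ← Complex.ofReal_mul, ← Complex.ofReal_mul, ← mul_assoc, mul_div_cancel₀ _ hpos.ne',
      sub_self]
  · rw [if_neg (by omega)] at e1
    rw [e1, mul_zero, zero_sub, neg_eq_zero]
    rcases hca.eq_or_lt with rfl | hlt
    · simp
    · rw [coefAt_eq (zeroVec p j k) (by omega), zeroVec_apply, if_neg (by dsimp only; omega),
        mul_zero]

/-- The two weights force m₁₁ = j and m₁₂ + m₂₂ = j + k, so v is determined by its coefficients at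
m₂₂ = s ≤ j. Vanishing of b₁⁻v propagates the coefficient at s = 0 to all others. -/
lemma eq_smul_zeroVec {p : ℝ} (hp : 1 < p) {j k : ℕ} (hjk : j ≤ k) {v : FinVec}
    (hw₁ : h₁ p v = ((p / 2 + j : ℝ) : ℂ) • v) (hw₂ : h₂ p v = ((p / 2 + k : ℝ) : ℂ) • v)
    (hb : bMinus p v = 0) : v = coefAt v (j + k) 0 j • zeroVec p j k := by
  have key : ∀ s : ℕ, s ≤ j →
      coefAt v (j + k - s) s j = coefAt v (j + k) 0 j * ((zeroCoef p j k s : ℝ) : ℂ) := by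
    intro s
    induction s with
    | zero => intro _; simp [zeroCoef]
    | succ s ih =>
      intro hs
      -- This is the pattern that b₁⁺ raises to both the s-th and the (s+1)-st candidate.
      have H := bMinus_apply p v ⟨j + k - 1 - s, s, j - 1, by omega, by omega, by omega⟩
      rw [hb, Finsupp.zero_apply] at H
      dsimp only at H
      have i1 : (j : ℤ) + k - 1 - s + 1 = j + k - s := by ring
      have i2 : (j : ℤ) - 1 + 1 = j := by ring
      have i3 : (j : ℤ) + k - 1 - s = j + k - (s + 1 : ℕ) := by push_cast; ring
      have r1 : ((((j : ℤ) - 1 : ℤ) : ℝ) - ((s : ℤ) : ℝ) + 1) = j - s := by push_cast; ring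
      have r2 : ((((j : ℤ) + k - 1 - s : ℤ) : ℝ) - (((j : ℤ) - 1 : ℤ) : ℝ)) = k - s := by
        push_cast; ring
      have hpos := zeroCoef_denom_pos hp hjk (show s < j by omega)
      rw [i1, i2, ih (by omega), r1, r2] at H
      rw [← i3, zeroCoef]
      push_cast at H ⊢
      have hpos' : ((Real.sqrt ((k : ℝ) - s) : ℝ) : ℂ) *
          ((f₂ p (j + k - 1 - s) s : ℝ) : ℂ) ≠ 0 := by
        rw [← Complex.ofReal_mul]; exact_mod_cast hpos.ne'
      apply mul_left_cancel₀ hpos'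
      rw [← sub_eq_zero.1 H.symm]
      generalize ((Real.sqrt ((k : ℝ) - s) : ℝ) : ℂ) *
          ((f₂ p (j + k - 1 - s) s : ℝ) : ℂ) = D at hpos' ⊢
      field_simp
  ext m
  rw [Finsupp.smul_apply, zeroVec_apply, smul_eq_mul]
  split_ifs with h
  · obtain ⟨a, b, c, hb, hbc, hca⟩ := m
    dsimp only at h ⊢
    lift b to ℕ using hb
    obtain ⟨rfl, h2⟩ := h
    obtain rfl : a = j + k - b := by omega
    rw [← coefAt_eq v (by omega), key b (by omega), Int.toNat_natCast]
  · rw [mul_zero]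
    by_contra hv
    apply h
    have H1 := DFunLike.congr_fun hw₁ m
    have H2 := DFunLike.congr_fun hw₂ m
    rw [h₁_apply, Finsupp.smul_apply, smul_eq_mul] at H1
    rw [h₂_apply, Finsupp.smul_apply, smul_eq_mul] at H2
    have H1' := Complex.ofReal_injective (mul_right_cancel₀ hv H1)
    have H2' := Complex.ofReal_injective (mul_right_cancel₀ hv H2)
    have g1 : (m.m11 : ℝ) = j := by linarith
    have g2 : (m.m12 : ℝ) + m.m22 = j + k := by linarith
    exact ⟨by exact_mod_cast g1, by exact_mod_cast g2⟩

lemma toFock_ne_zero {v : FinVec} (h : v ≠ 0) : toFock v ≠ 0 := by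
  intro h0
  apply h
  ext m
  rw [← inner_single_toFock, h0, inner_zero_right, Finsupp.zero_apply]

lemma zeroVec_ne_zero (p : ℝ) {j k : ℕ} (hjk : j ≤ k) : zeroVec p j k ≠ 0 := by
  intro h
  have := zeroVec_apply p j k ⟨j + k, 0, j, by omega, by omega, by omega⟩
  rw [h] at this
  simp [zeroCoef] at this

theorem exists_unique_zeroMode {p : ℝ} (hp : 1 < p) {j k : ℕ} (hjk : j ≤ k) :
    ∃ ζ : FinVec, IsZeroMode p j k ζ ∧
      ∀ ζ' : FinVec, IsZeroMode p j k ζ' → ∃ c : ℂ, ‖c‖ = 1 ∧ ζ' = c • ζ := by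
  have hn : ‖toFock (zeroVec p j k)‖ ≠ 0 :=
    norm_ne_zero_iff.2 (toFock_ne_zero (zeroVec_ne_zero p hjk))
  set r := ‖toFock (zeroVec p j k)‖ with hr
  have hr' : (r : ℂ) ≠ 0 := by exact_mod_cast hn
  refine ⟨((r⁻¹ : ℝ) : ℂ) • zeroVec p j k, ⟨?_, ?_, ?_, ?_⟩, fun ζ' h => ?_⟩
  · rw [map_smul, weight_zeroVec₁, smul_comm]
  · rw [map_smul, weight_zeroVec₂, smul_comm]
  · rw [map_smul, bMinus_zeroVec hp hjk, smul_zero]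
  · rw [map_smul, norm_smul, ← hr, Complex.norm_real, norm_inv, hr, norm_norm, ← hr,
      inv_mul_cancel₀ hn]
  · have H := eq_smul_zeroVec hp hjk h.weight₁ h.weight₂ h.annihilated
    refine ⟨coefAt ζ' (j + k) 0 j * r, ?_, ?_⟩
    · have := h.normalized
      rw [H, map_smul, norm_smul, ← hr] at this
      rw [norm_mul, Complex.norm_real, hr, norm_norm, ← hr, this]
    · rw [smul_smul, mul_assoc, Complex.ofReal_inv, mul_inv_cancel₀ hr', mul_one]
      exact H

/-! ### Number states -/

/-- Expansion of the vectors in the closed span of an orthonormal sequence. -/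
lemma Orthonormal.hasSum_of_mem_closure {E : Type*} [NormedAddCommGroup E] [InnerProductSpace ℂ E]
    [CompleteSpace E] {e : ℕ → E} (he : Orthonormal ℂ e) {v : E}
    (hv : v ∈ (Submodule.span ℂ (Set.range e)).topologicalClosure) :
    HasSum (fun n => (inner ℂ (e n) v : ℂ) • e n) v := by
  set V := (Submodule.span ℂ (Set.range e)).topologicalClosure with hV
  have heV : ∀ n, e n ∈ V := fun n =>
    Submodule.le_topologicalClosure _ (Submodule.subset_span ⟨n, rfl⟩)
  have hsum : Summable (fun n => (inner ℂ (e n) v : ℂ) • e n) := by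
    have := (he.orthogonalFamily.summable_iff_norm_sq_summable
      (fun n => (inner ℂ (e n) v : ℂ))).2 (he.inner_products_summable v)
    simpa using this
  obtain ⟨w, hw⟩ := hsum
  have hwV : w ∈ V := by
    refine (Submodule.isClosed_topologicalClosure _).mem_of_tendsto hw
      (Filter.Eventually.of_forall fun s => ?_)
    exact Submodule.sum_mem _ fun n _ => Submodule.smul_mem _ _ (heV n)
  have horth : ∀ n, inner ℂ (e n) (v - w) = (0 : ℂ) := by
    intro n
    have h1 := hw.mapL (innerSL ℂ (e n))
    simp only [innerSL_apply_apply, inner_smul_right, orthonormal_iff_ite.1 he] at h1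
    have h2 := h1.unique (hasSum_single n (fun m hm => by simp [hm.symm]))
    rw [inner_sub_right, h2]
    simp
  -- All of V is orthogonal to v - w, which itself lies in V and must be 0.
  have hle : V ≤ (ℂ ∙ (v - w))ᗮ := by
    refine Submodule.topologicalClosure_minimal _ (Submodule.span_le.2 ?_)
      (Submodule.isClosed_orthogonal _)
    rintro _ ⟨n, rfl⟩
    exact Submodule.mem_orthogonal_singleton_iff_inner_left.2 (horth n)
  have h0 : v - w = 0 := by
    have := hle (V.sub_mem hv hwV)
    rwa [Submodule.mem_orthogonal_singleton_iff_inner_left, inner_self_eq_zero] at this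
  rw [sub_eq_zero] at h0
  rwa [← h0] at hw

/-- The eigenvalue of `b₁⁺ b₁⁻` on the `n`-th number state. -/
def ladder (p : ℝ) (j n : ℕ) : ℝ := if Even n then n else p + 2 * j + n - 1

/-- The squared norm of `(b₁⁺)ⁿ ζ`. -/
def normSq (p : ℝ) (j n : ℕ) : ℝ :=
  2 ^ n * ((n / 2).factorial : ℝ) * ∏ i ∈ Finset.range ((n + 1) / 2), (p / 2 + j + i)

lemma ladder_ge {p : ℝ} (hp : 1 < p) (j n : ℕ) : (n : ℝ) ≤ ladder p j n := by
  unfold ladder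
  split_ifs
  · exact le_rfl
  · have : (0 : ℝ) ≤ j := j.cast_nonneg
    linarith

lemma ladder_succ_pos {p : ℝ} (hp : 1 < p) (j n : ℕ) : 0 < ladder p j (n + 1) :=
  lt_of_lt_of_le (by positivity) (ladder_ge hp j (n + 1))

lemma normSq_zero (p : ℝ) (j : ℕ) : normSq p j 0 = 1 := by simp [normSq]

lemma normSq_succ (p : ℝ) (j n : ℕ) : normSq p j (n + 1) = ladder p j (n + 1) * normSq p j n := by
  rcases Nat.even_or_odd' n with ⟨m, rfl | rfl⟩
  · have h1 : (2 * m + 1) / 2 = m := by omega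
    have h2 : (2 * m + 1 + 1) / 2 = m + 1 := by omega
    have h3 : 2 * m / 2 = m := by omega
    have h4 : ¬ Even (2 * m + 1) := by simp
    rw [normSq, normSq, ladder, if_neg h4, h1, h2, h3, Finset.prod_range_succ, pow_succ]
    push_cast
    ring
  · have h1 : (2 * m + 1) / 2 = m := by omega
    have h2 : (2 * m + 1 + 1) / 2 = m + 1 := by omega
    have h3 : (2 * m + 1 + 1 + 1) / 2 = m + 1 := by omega
    have h4 : Even (2 * m + 1 + 1) := ⟨m + 1, by ring⟩
    rw [normSq, normSq, ladder, if_pos h4, h1, h2, h3, Nat.factorial_succ, pow_succ 2 (2 * m + 1)]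
    push_cast
    ring

/-- Each factor `ladder p j i` is at least i. This compares the coherent state series with the
exponential series. -/
lemma normSq_ge {p : ℝ} (hp : 1 < p) (j n : ℕ) : (n.factorial : ℝ) ≤ normSq p j n := by
  induction n with
  | zero => simp [normSq_zero]
  | succ n ih =>
    rw [normSq_succ, Nat.factorial_succ]
    push_cast
    have := ladder_ge hp j (n + 1)
    push_cast at this
    have h0 := (ladder_succ_pos hp j n).le
    gcongr

lemma normSq_pos {p : ℝ} (hp : 1 < p) (j n : ℕ) : 0 < normSq p j n :=
  lt_of_lt_of_le (by positivity) (normSq_ge hp j n)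

namespace IsZeroMode

variable {p : ℝ} {j k : ℕ} {ζ : FinVec}

lemma h₁_bPlus_pow (hζ : IsZeroMode p j k ζ) (n : ℕ) :
    h₁ p ((bPlus p ^ n) ζ) = ((p / 2 + j + n : ℝ) : ℂ) • (bPlus p ^ n) ζ := by
  induction n with
  | zero => simpa using hζ.weight₁
  | succ n ih =>
    rw [pow_succ', Module.End.mul_apply, h₁_bPlus, ih, map_smul]
    push_cast
    module

/-- The anticommutator applied to (b₁⁺)ⁿζ gives λₙ₊₁ + λₙ = 2(p/2 + j + n) with λ₀ = 0. The solution
alternates between n and p + 2j + n - 1, which is the definition of `ladder`. -/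
lemma bMinus_bPlus_pow (hp : 1 < p) (hζ : IsZeroMode p j k ζ) (n : ℕ) :
    bMinus p (bPlus p ((bPlus p ^ n) ζ)) = ((ladder p j (n + 1) : ℝ) : ℂ) • (bPlus p ^ n) ζ := by
  induction n with
  | zero =>
    have := anticomm hp ζ
    rw [hζ.annihilated, map_zero, add_zero, hζ.weight₁] at this
    simp only [pow_zero, Module.End.one_apply, zero_add, this, ladder, Nat.not_even_one, if_false]
    push_cast
    module
  | succ n ih =>
    have := anticomm hp ((bPlus p ^ (n + 1)) ζ)
    rw [hζ.h₁_bPlus_pow] at this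
    rw [pow_succ', Module.End.mul_apply] at this ⊢
    rw [ih, map_smul] at this
    rw [eq_sub_of_add_eq this, smul_smul, ← sub_smul]
    congr 1
    rw [← Complex.ofReal_ofNat, ← Complex.ofReal_mul, ← Complex.ofReal_sub]
    congr 1
    rcases Nat.even_or_odd n with h | h
    · have h1 : ¬ Even (n + 1) := by simpa [Nat.even_add_one] using h
      have h2 : Even (n + 1 + 1) := by simpa [Nat.even_add_one] using h
      rw [ladder, ladder, if_neg h1, if_pos h2]
      push_cast; ring
    · have h0 := Nat.not_even_iff_odd.2 h
      have h1 : Even (n + 1) := by simpa [Nat.even_add_one] using h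
      have h2 : ¬ Even (n + 1 + 1) := by simpa [Nat.even_add_one] using h
      rw [ladder, ladder, if_pos h1, if_neg h2]
      push_cast; ring

/-- Moving one b₁⁺ across the inner product lowers both exponents by one and yields a factor λₙ;
when one exponent reaches 0 first, b₁⁻ζ = 0 ends the computation. -/
lemma inner_bPlus_pow (hp : 1 < p) (hζ : IsZeroMode p j k ζ) (m n : ℕ) :
    inner ℂ (toFock ((bPlus p ^ m) ζ)) (toFock ((bPlus p ^ n) ζ)) =
      if m = n then ((normSq p j n : ℝ) : ℂ) else 0 := by
  have h0 : ∀ m, inner ℂ (toFock ((bPlus p ^ (m + 1)) ζ)) (toFock ζ) = (0 : ℂ) := by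
    intro m
    rw [pow_succ', Module.End.mul_apply, inner_bPlus, hζ.annihilated, map_zero, inner_zero_right]
  induction m generalizing n with
  | zero =>
    cases n with
    | zero => simp [normSq_zero, inner_self_eq_norm_sq_to_K, hζ.normalized]
    | succ n => rw [← inner_conj_symm]; simp [h0]
  | succ m ih =>
    cases n with
    | zero => simp [h0]
    | succ n =>
      rw [pow_succ', Module.End.mul_apply, inner_bPlus, pow_succ', Module.End.mul_apply,
        hζ.bMinus_bPlus_pow hp, map_smul, inner_smul_right, ih, normSq_succ]
      simp

lemma toFock_bPlus_pow (hp : 1 < p) (n : ℕ) :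
    toFock ((bPlus p ^ n) ζ) = ((Real.sqrt (normSq p j n) : ℝ) : ℂ) • numberState p j ζ n := by
  have : Real.sqrt (normSq p j n) ≠ 0 := (Real.sqrt_pos.2 (normSq_pos hp j n)).ne'
  rw [numberState, smul_smul, ← Complex.ofReal_mul]
  change _ = ((Real.sqrt (normSq p j n) * (Real.sqrt (normSq p j n))⁻¹ : ℝ) : ℂ) • _
  rw [mul_inv_cancel₀ this, Complex.ofReal_one, one_smul]

lemma orthonormal_numberState (hp : 1 < p) (hζ : IsZeroMode p j k ζ) :
    Orthonormal ℂ (numberState p j ζ) := by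
  classical
  rw [orthonormal_iff_ite]
  intro m n
  have h := hζ.inner_bPlus_pow hp m n
  rw [toFock_bPlus_pow (j := j) hp, toFock_bPlus_pow (j := j) hp, inner_smul_left,
    inner_smul_right, Complex.conj_ofReal] at h
  have hpos : ∀ n, ((Real.sqrt (normSq p j n) : ℝ) : ℂ) ≠ 0 := fun n => by
    exact_mod_cast (Real.sqrt_pos.2 (normSq_pos hp j n)).ne'
  by_cases hmn : m = n
  · subst hmn
    rw [if_pos rfl] at h ⊢
    apply mul_left_cancel₀ (hpos m)
    apply mul_left_cancel₀ (hpos m)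
    rw [h, mul_one, ← Complex.ofReal_mul, Real.mul_self_sqrt (normSq_pos hp j m).le]
  · rw [if_neg hmn] at h ⊢
    simpa [hpos] using h

lemma cyclicSubspace_eq (hp : 1 < p) : cyclicSubspace p ζ =
    (Submodule.span ℂ (Set.range (numberState p j ζ))).topologicalClosure := by
  unfold cyclicSubspace
  congr 1
  refine le_antisymm (Submodule.span_le.2 ?_) (Submodule.span_le.2 ?_)
  · rintro _ ⟨n, rfl⟩
    simp only [toFock_bPlus_pow (j := j) hp]
    exact Submodule.smul_mem _ _ (Submodule.subset_span ⟨n, rfl⟩)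
  · rintro _ ⟨n, rfl⟩
    exact Submodule.smul_mem _ _ (Submodule.subset_span ⟨n, rfl⟩)

lemma hasSum_numberState (hp : 1 < p) (hζ : IsZeroMode p j k ζ) {v : Fock}
    (hv : v ∈ cyclicSubspace p ζ) :
    HasSum (fun n => (inner ℂ (numberState p j ζ n) v : ℂ) • numberState p j ζ n) v := by
  rw [cyclicSubspace_eq (j := j) hp] at hv
  exact Orthonormal.hasSum_of_mem_closure (hζ.orthonormal_numberState hp) hv

lemma numberState_mem (n : ℕ) : numberState p j ζ n ∈ cyclicSubspace p ζ :=
  Submodule.smul_mem _ _ (Submodule.le_topologicalClosure _ (Submodule.subset_span ⟨n, rfl⟩))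

/-! ### Coherent states -/

lemma bPlus_pow_ne_zero (hp : 1 < p) (hζ : IsZeroMode p j k ζ) (n : ℕ) :
    (bPlus p ^ n) ζ ≠ 0 := by
  intro h
  have := hζ.inner_bPlus_pow hp n n
  rw [h, map_zero, inner_zero_left, if_pos rfl] at this
  exact (normSq_pos hp j n).ne (by exact_mod_cast this)

/-- A nonzero vector has only one eigenvalue, so the value chosen in `T₁inv` is the given c. -/
lemma T₁inv_eq {c : ℂ} (hc : c ≠ 0) {v : FinVec} (hv : v ≠ 0) (h : T₁ p v = c • v) :
    T₁inv p v = c⁻¹ • v := by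
  have hex : ∃ c : ℂ, c ≠ 0 ∧ T₁ p v = c • v := ⟨c, hc, h⟩
  rw [T₁inv, dif_pos hex]
  have h2 := hex.choose_spec.2
  rw [← smul_left_injective ℂ hv (h.symm.trans h2)]

lemma iterate_vertex (hp : 1 < p) (hζ : IsZeroMode p j k ζ) (n : ℕ) :
    (fun v => bPlus p (T₁inv p v))^[n] ζ = (((normSq p j n)⁻¹ : ℝ) : ℂ) • (bPlus p ^ n) ζ := by
  induction n with
  | zero => simp [normSq_zero]
  | succ n ih =>
    have hl : ((ladder p j (n + 1) : ℝ) : ℂ) ≠ 0 := by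
      exact_mod_cast (ladder_succ_pos hp j n).ne'
    have hN : (((normSq p j n)⁻¹ : ℝ) : ℂ) ≠ 0 := by
      exact_mod_cast (inv_pos.2 (normSq_pos hp j n)).ne'
    rw [Function.iterate_succ_apply', ih, T₁inv_eq hl
      (smul_ne_zero hN (hζ.bPlus_pow_ne_zero hp n)), map_smul, map_smul, smul_smul, pow_succ',
      Module.End.mul_apply, normSq_succ, mul_inv]
    · push_cast; rfl
    · rw [map_smul, T₁, LinearMap.comp_apply, hζ.bMinus_bPlus_pow hp, smul_comm]

end IsZeroMode

/-! ### Modified Bessel functions -/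

lemma sq_div_four_le_cosh {t : ℝ} (ht : 0 ≤ t) : t ^ 2 / 4 ≤ Real.cosh t := by
  have h := Real.quadratic_le_exp_of_nonneg ht
  have h2 := Real.exp_pos (-t)
  rw [Real.cosh_eq]
  linarith

/-- Since cosh t ≥ t²/4, the integrand is dominated by a Gaussian. -/
lemma integrableOn_besselK (ν : ℝ) {x : ℝ} (hx : 0 < x) :
    IntegrableOn (fun t => Real.exp (-(x * Real.cosh t)) * Real.cosh (ν * t)) (Set.Ioi 0) := by
  have hg : IntegrableOn (fun t : ℝ => Real.exp (2 * ν ^ 2 / x) * Real.exp (-(x / 8) * t ^ 2))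
      (Set.Ioi 0) :=
    ((integrable_exp_neg_mul_sq (by positivity)).const_mul _).integrableOn
  refine hg.mono' (by fun_prop) ((ae_restrict_iff' measurableSet_Ioi).2 (ae_of_all _ fun t ht => ?_))
  have ht0 : 0 ≤ t := le_of_lt ht
  have hc : Real.cosh (ν * t) ≤ Real.exp (|ν| * t) := by
    rw [← Real.cosh_abs, abs_mul, abs_of_nonneg ht0, Real.cosh_eq]
    have : Real.exp (-(|ν| * t)) ≤ Real.exp (|ν| * t) :=
      Real.exp_le_exp.2 (by have := mul_nonneg (abs_nonneg ν) ht0; linarith)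
    linarith
  rw [Real.norm_of_nonneg (mul_nonneg (Real.exp_pos _).le (Real.cosh_pos _).le)]
  calc Real.exp (-(x * Real.cosh t)) * Real.cosh (ν * t)
      ≤ Real.exp (-(x * (t ^ 2 / 4))) * Real.exp (|ν| * t) := by
        gcongr
        exact sq_div_four_le_cosh ht0
    _ ≤ Real.exp (2 * ν ^ 2 / x) * Real.exp (-(x / 8) * t ^ 2) := by
        rw [← Real.exp_add, ← Real.exp_add, Real.exp_le_exp]
        -- Half of the quadratic decay absorbs the linear term |ν|t; completing the square fixes the
        -- constant 2ν²/x.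
        have h1 : 2 * ν ^ 2 / x + -(x / 8) * t ^ 2 - (-(x * (t ^ 2 / 4)) + |ν| * t) =
            (x * t - 4 * |ν|) ^ 2 / (8 * x) := by
          rw [← sq_abs ν]
          field_simp
          ring
        have h2 : 0 ≤ (x * t - 4 * |ν|) ^ 2 / (8 * x) := by positivity
        linarith

lemma besselK_pos (ν : ℝ) {x : ℝ} (hx : 0 < x) : 0 < besselK ν x := by
  unfold besselK
  rw [setIntegral_pos_iff_support_of_nonneg_ae
    (ae_of_all _ fun t => mul_nonneg (Real.exp_pos _).le (Real.cosh_pos _).le)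
    (integrableOn_besselK ν hx)]
  have : (Function.support fun t => Real.exp (-(x * Real.cosh t)) * Real.cosh (ν * t)) =
      Set.univ := by
    ext t
    simp [(Real.cosh_pos (ν * t)).ne', (Real.exp_pos (-(x * Real.cosh t))).ne']
  rw [this, Set.univ_inter]
  simp

lemma besselK_nonneg (ν x : ℝ) : 0 ≤ besselK ν x :=
  setIntegral_nonneg measurableSet_Ioi fun _ _ =>
    mul_nonneg (Real.exp_pos _).le (Real.cosh_pos _).le

lemma besselK_le {μ ν x : ℝ} (h : |μ| ≤ |ν|) (hx : 0 < x) : besselK μ x ≤ besselK ν x := by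
  refine setIntegral_mono (integrableOn_besselK μ hx) (integrableOn_besselK ν hx) fun t => ?_
  refine mul_le_mul_of_nonneg_left ?_ (Real.exp_pos _).le
  rw [Real.cosh_le_cosh, abs_mul, abs_mul]
  gcongr

lemma measurable_besselK (ν : ℝ) : Measurable (besselK ν) := by
  have : StronglyMeasurable (fun z : ℝ × ℝ =>
      Real.exp (-(z.1 * Real.cosh z.2)) * Real.cosh (ν * z.2)) := by
    refine Continuous.stronglyMeasurable ?_
    fun_prop
  exact (this.integral_prod_right (ν := volume.restrict (Set.Ioi 0))).measurable

/-- Folding the line at 0 combines exp(νt) and exp(-νt) into 2 cosh(νt). The pure exponential on the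
whole line is the form suited to substitutions. -/
lemma ofReal_besselK (ν : ℝ) {x : ℝ} (hx : 0 < x) : ENNReal.ofReal (2 * besselK ν x) =
    ∫⁻ t : ℝ, ENNReal.ofReal (Real.exp (-(x * Real.cosh t)) * Real.exp (ν * t)) := by
  have hneg : ∫⁻ t in Set.Iic (0 : ℝ),
        ENNReal.ofReal (Real.exp (-(x * Real.cosh t)) * Real.exp (ν * t)) =
      ∫⁻ t in Set.Ioi (0 : ℝ),
        ENNReal.ofReal (Real.exp (-(x * Real.cosh t)) * Real.exp (-(ν * t))) := by
    have h1 : (fun t : ℝ => -t) '' Set.Ioi 0 = Set.Iio 0 := by simp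
    rw [setLIntegral_congr Iio_ae_eq_Iic.symm, ← h1,
      lintegral_image_eq_lintegral_abs_deriv_mul (f' := fun _ => -1) measurableSet_Ioi
        (fun t _ => (hasDerivAt_neg t).hasDerivWithinAt) neg_injective.injOn]
    simp
  rw [← lintegral_add_compl _ (measurableSet_Ioi (a := (0 : ℝ))), Set.compl_Ioi, hneg,
    ← lintegral_add_left (by fun_prop), besselK, ← integral_const_mul,
    ofReal_integral_eq_lintegral_ofReal ((integrableOn_besselK ν hx).const_mul 2)
    (ae_of_all _ fun t => by
      have := Real.exp_pos (-(x * Real.cosh t))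
      have := Real.cosh_pos (ν * t)
      dsimp only [Pi.zero_apply]
      positivity)]
  refine lintegral_congr fun t => ?_
  rw [← ENNReal.ofReal_add (by positivity) (by positivity), Real.cosh_eq (ν * t)]
  congr 1
  ring

lemma lintegral_Gamma {s : ℝ} (hs : 0 < s) {c : ℝ} (hc : 0 < c) :
    ∫⁻ x in Set.Ioi (0 : ℝ), ENNReal.ofReal (x ^ (s - 1) * Real.exp (-(c * x))) =
      ENNReal.ofReal ((1 / c) ^ s * Real.Gamma s) := by
  rw [← Real.integral_rpow_mul_exp_neg_mul_Ioi hs hc, ofReal_integral_eq_lintegral_ofReal]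
  · have := integrableOn_rpow_mul_exp_neg_mul_rpow (p := 1) (s := s - 1) (by linarith) one_pos hc
    simpa [IntegrableOn] using this
  · refine (ae_restrict_iff' measurableSet_Ioi).2 (ae_of_all _ fun t ht => ?_)
    have : (0 : ℝ) < t := ht
    dsimp only [Pi.zero_apply]
    positivity

/-- Tonelli, followed by the Gamma integral in x. With values in [0, ∞] no integrability has to be
known beforehand. -/
lemma lintegral_swap_Gamma {s : ℝ} (hs : 0 < s) {c w : ℝ → ℝ} (hc : ∀ t, 0 < c t)
    (hw : ∀ t, 0 ≤ w t) (hcm : Continuous c) (hwm : Continuous w) :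
    ∫⁻ x in Set.Ioi (0 : ℝ), ∫⁻ t : ℝ,
        ENNReal.ofReal (x ^ (s - 1) * Real.exp (-(c t * x)) * w t) =
      ∫⁻ t : ℝ, ENNReal.ofReal ((1 / c t) ^ s * Real.Gamma s * w t) := by
  rw [lintegral_lintegral_swap]
  · refine lintegral_congr fun t => ?_
    simp_rw [ENNReal.ofReal_mul' (hw t)]
    rw [lintegral_mul_const' _ _ ENNReal.ofReal_ne_top, lintegral_Gamma hs (hc t)]
  · refine Measurable.aemeasurable (Measurable.ennreal_ofReal ?_)
    exact ((measurable_fst.pow_const _).mul (by fun_prop)).mul (by fun_prop)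

lemma lintegral_rpow_mul_besselK {s : ℝ} (hs : 0 < s) (μ : ℝ) :
    ∫⁻ x in Set.Ioi (0 : ℝ), ENNReal.ofReal (x ^ (s - 1) * (2 * besselK μ x)) =
      ∫⁻ t : ℝ, ENNReal.ofReal ((1 / Real.cosh t) ^ s * Real.Gamma s * Real.exp (μ * t)) := by
  rw [← lintegral_swap_Gamma hs Real.cosh_pos (fun t => (Real.exp_pos _).le)
    Real.continuous_cosh (by fun_prop)]
  refine setLIntegral_congr_fun measurableSet_Ioi fun x hx => ?_
  have hx0 : (0 : ℝ) < x := hx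
  rw [ENNReal.ofReal_mul (by positivity), ofReal_besselK μ hx0,
    ← lintegral_const_mul' _ _ ENNReal.ofReal_ne_top]
  refine lintegral_congr fun t => ?_
  rw [← ENNReal.ofReal_mul (by positivity), mul_assoc, mul_comm x]

/-- The substitution y = x·exp(-2t) in the Gamma integral. The free scale x is later the other
integration variable. -/
lemma lintegral_Gamma_subst {b x : ℝ} (hb : 0 < b) (hx : 0 < x) :
    ENNReal.ofReal (Real.Gamma b) = ∫⁻ t : ℝ, ENNReal.ofReal
      (2 * x ^ b * Real.exp (-(Real.exp (-2 * t) * x)) * Real.exp (-2 * b * t)) := by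
  have h := lintegral_Gamma hb one_pos
  simp only [div_one, Real.one_rpow, one_mul] at h
  have himg : (fun t : ℝ => x * Real.exp (-2 * t)) '' Set.univ = Set.Ioi 0 := by
    ext y
    simp only [Set.image_univ, Set.mem_range, Set.mem_Ioi]
    constructor
    · rintro ⟨t, rfl⟩
      positivity
    · intro hy
      refine ⟨-Real.log (y / x) / 2, ?_⟩
      rw [show -2 * (-Real.log (y / x) / 2) = Real.log (y / x) by ring,
        Real.exp_log (by positivity)]
      field_simp
  have hinj : Set.InjOn (fun t : ℝ => x * Real.exp (-2 * t)) Set.univ := by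
    intro t _ t' _ h
    have := Real.exp_injective (mul_left_cancel₀ hx.ne' h)
    linarith
  have hd : ∀ t ∈ Set.univ, HasDerivWithinAt (fun t : ℝ => x * Real.exp (-2 * t))
      (x * (Real.exp (-2 * t) * -2)) Set.univ t := by
    intro t _
    have h := (((hasDerivAt_id t).const_mul (-2 : ℝ)).exp).const_mul x
    rw [mul_one] at h
    exact h.hasDerivWithinAt
  rw [← h, ← himg, lintegral_image_eq_lintegral_abs_deriv_mul MeasurableSet.univ hd hinj,
    Measure.restrict_univ]
  refine lintegral_congr fun t => ?_
  rw [← ENNReal.ofReal_mul (abs_nonneg _)]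
  congr 1
  have e1 : |x * (Real.exp (-2 * t) * -2)| = 2 * (x * Real.exp (-2 * t)) := by
    rw [abs_mul, abs_mul, abs_of_pos hx, abs_of_pos (Real.exp_pos _), abs_neg, abs_two]
    ring
  have e2 : (x * Real.exp (-2 * t)) ^ (b - 1) =
      (x ^ b * Real.exp (-2 * b * t)) / (x * Real.exp (-2 * t)) := by
    rw [Real.rpow_sub_one (by positivity), Real.mul_rpow hx.le (Real.exp_pos _).le,
      ← Real.exp_mul]
    ring_nf
  have e3 : x * Real.exp (-2 * t) ≠ 0 := by positivity
  rw [e1, e2, mul_comm (Real.exp (-2 * t)) x]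
  field_simp

/-- The Mellin transform of `K_μ`. -/
lemma lintegral_besselK_moment {s μ : ℝ} (h : |μ| < s) :
    ∫⁻ x in Set.Ioi (0 : ℝ), ENNReal.ofReal (x ^ (s - 1) * besselK μ x) =
      ENNReal.ofReal (2 ^ (s - 2) * Real.Gamma ((s - μ) / 2) * Real.Gamma ((s + μ) / 2)) := by
  obtain ⟨h1, h2⟩ := abs_lt.1 h
  have hs : 0 < s := (abs_nonneg μ).trans_lt h
  have ha : 0 < (s + μ) / 2 := by linarith
  have hb : 0 < (s - μ) / 2 := by linarith
  -- Write Γ((s+μ)/2) as an integral in x and, under it, Γ((s-μ)/2) by `lintegral_Gamma_subst` at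
  -- scale x. The powers of x merge to x^(s-1), and integrating in x first leaves a single integral
  -- in t.
  have H : ENNReal.ofReal (Real.Gamma ((s + μ) / 2) * Real.Gamma ((s - μ) / 2)) =
      ∫⁻ t : ℝ, ENNReal.ofReal ((1 / (1 + Real.exp (-2 * t))) ^ s * Real.Gamma s *
        (2 * Real.exp (-2 * ((s - μ) / 2) * t))) := by
    rw [← lintegral_swap_Gamma hs (fun t => by positivity) (fun t => by positivity)
      (by fun_prop) (by fun_prop)]
    have hg := lintegral_Gamma ha one_pos
    simp only [div_one, Real.one_rpow, one_mul] at hg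
    rw [ENNReal.ofReal_mul' (Real.Gamma_pos_of_pos hb).le, ← hg,
      ← lintegral_mul_const' _ _ ENNReal.ofReal_ne_top]
    refine setLIntegral_congr_fun measurableSet_Ioi fun x hx => ?_
    have hx0 : (0 : ℝ) < x := hx
    rw [lintegral_Gamma_subst hb hx0, ← lintegral_const_mul' _ _ ENNReal.ofReal_ne_top]
    refine lintegral_congr fun t => ?_
    rw [← ENNReal.ofReal_mul (by positivity)]
    congr 1
    have e1 : x ^ (s - 1) = x ^ ((s + μ) / 2 - 1) * x ^ ((s - μ) / 2) := by
      rw [← Real.rpow_add hx0]; ring_nf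
    have e2 : Real.exp (-((1 + Real.exp (-2 * t)) * x)) =
        Real.exp (-x) * Real.exp (-(Real.exp (-2 * t) * x)) := by
      rw [← Real.exp_add]; ring_nf
    rw [e1, e2]
    ring
  -- From 1 + exp(-2t) = 2 exp(-t) cosh t: up to 2^(1-s) this is the integrand of
  -- `lintegral_rpow_mul_besselK`.
  have H2 : ∀ t : ℝ, (1 / (1 + Real.exp (-2 * t))) ^ s * Real.Gamma s *
        (2 * Real.exp (-2 * ((s - μ) / 2) * t)) =
      2 ^ (1 - s) * ((1 / Real.cosh t) ^ s * Real.Gamma s * Real.exp (μ * t)) := by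
    intro t
    have e1 : 1 / (1 + Real.exp (-2 * t)) = 2⁻¹ * (Real.exp t * (1 / Real.cosh t)) := by
      have : Real.exp (-2 * t) = Real.exp (-t) * Real.exp (-t) := by
        rw [← Real.exp_add]; ring_nf
      rw [this, Real.cosh_eq, Real.exp_neg]
      field_simp
    have hc := Real.cosh_pos t
    rw [e1, Real.mul_rpow (by norm_num) (by positivity), Real.mul_rpow (by positivity)
      (by positivity), ← Real.exp_mul, Real.inv_rpow (by norm_num), Real.rpow_sub (by norm_num),
      Real.rpow_one]
    have e2 : Real.exp (μ * t) = Real.exp (t * s) * Real.exp (-2 * ((s - μ) / 2) * t) := by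
      rw [← Real.exp_add]; ring_nf
    rw [e2]
    ring
  simp_rw [H2] at H
  have p1 : (0 : ℝ) < 2 ^ (1 - s) := by positivity
  simp_rw [ENNReal.ofReal_mul p1.le] at H
  rw [lintegral_const_mul' _ _ ENNReal.ofReal_ne_top, ← lintegral_rpow_mul_besselK hs μ,
    ← lintegral_const_mul' _ _ ENNReal.ofReal_ne_top] at H
  have p2 : (0 : ℝ) < 2 ^ (s - 2) := by positivity
  have e3 : (2 : ℝ) ^ (s - 2) * 2 ^ (1 - s) * 2 = 1 := by
    rw [← Real.rpow_add (by norm_num), ← Real.rpow_add_one (by norm_num)]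
    ring_nf
    simp
  rw [mul_assoc, mul_comm (Real.Gamma ((s - μ) / 2)), ENNReal.ofReal_mul p2.le, H,
    ← lintegral_const_mul' _ _ ENNReal.ofReal_ne_top]
  refine lintegral_congr fun x => ?_
  rw [← ENNReal.ofReal_mul p1.le, ← ENNReal.ofReal_mul p2.le]
  congr 1
  linear_combination (-x ^ (s - 1) * besselK μ x) * e3

lemma integrableOn_besselK_moment {s μ : ℝ} (h : |μ| < s) :
    IntegrableOn (fun x => x ^ (s - 1) * besselK μ x) (Set.Ioi 0) := by
  refine ⟨((Measurable.pow_const measurable_id _).mul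
    (measurable_besselK μ)).aestronglyMeasurable, ?_⟩
  rw [hasFiniteIntegral_iff_ofReal ((ae_restrict_iff' measurableSet_Ioi).2
    (ae_of_all _ fun x hx => mul_nonneg (Real.rpow_nonneg (le_of_lt hx) _) (besselK_nonneg μ x))),
    lintegral_besselK_moment h]
  exact ENNReal.ofReal_lt_top

lemma integral_besselK_moment {s μ : ℝ} (h : |μ| < s) :
    ∫ x in Set.Ioi (0 : ℝ), x ^ (s - 1) * besselK μ x =
      2 ^ (s - 2) * Real.Gamma ((s - μ) / 2) * Real.Gamma ((s + μ) / 2) := by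
  obtain ⟨h1, h2⟩ := abs_lt.1 h
  rw [integral_eq_lintegral_of_nonneg_ae ((ae_restrict_iff' measurableSet_Ioi).2
    (ae_of_all _ fun x hx => mul_nonneg (Real.rpow_nonneg (le_of_lt hx) _) (besselK_nonneg μ x)))
    (integrableOn_besselK_moment h).1, lintegral_besselK_moment h, ENNReal.toReal_ofReal]
  have := Real.Gamma_pos_of_pos (show 0 < (s - μ) / 2 by linarith)
  have := Real.Gamma_pos_of_pos (show 0 < (s + μ) / 2 by linarith)
  positivity

/-! ### Coherent states in the number basis, their parity parts and cat states -/

namespace IsZeroMode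

variable {p : ℝ} {j k : ℕ} {ζ : FinVec}

lemma hasSum_inner (hp : 1 < p) (hζ : IsZeroMode p j k ζ) (u : Fock) {v : Fock}
    (hv : v ∈ cyclicSubspace p ζ) :
    HasSum (fun n => inner ℂ (numberState p j ζ n) v * inner ℂ u (numberState p j ζ n))
      (inner ℂ u v : ℂ) := by
  have := (hζ.hasSum_numberState hp hv).mapL (innerSL ℂ u)
  simpa [inner_smul_right] using this

lemma hasSum_norm_sq (hp : 1 < p) (hζ : IsZeroMode p j k ζ) {v : Fock}
    (hv : v ∈ cyclicSubspace p ζ) :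
    HasSum (fun n => ‖(inner ℂ (numberState p j ζ n) v : ℂ)‖ ^ 2) (‖v‖ ^ 2) := by
  have := hζ.hasSum_inner hp v hv
  rw [inner_self_eq_norm_sq_to_K] at this
  rw [← Complex.hasSum_ofReal]
  convert this using 1
  · ext n
    rw [← inner_conj_symm v, Complex.mul_conj, Complex.normSq_eq_norm_sq]
  · simp

lemma vertexTerm_eq (hp : 1 < p) (hζ : IsZeroMode p j k ζ) (α : ℂ) (n : ℕ) :
    vertexTerm p ζ α n =
      (α ^ n * (((Real.sqrt (normSq p j n))⁻¹ : ℝ) : ℂ)) • numberState p j ζ n := by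
  have hN := normSq_pos hp j n
  rw [vertexTerm, hζ.iterate_vertex hp, map_smul, toFock_bPlus_pow (j := j) hp, smul_smul,
    smul_smul, mul_assoc, ← Complex.ofReal_mul, inv_mul_eq_div, Real.sqrt_div_self]

lemma norm_coef_sq (hp : 1 < p) (α : ℂ) (n : ℕ) :
    ‖α ^ n * (((Real.sqrt (normSq p j n))⁻¹ : ℝ) : ℂ)‖ ^ 2 = (‖α‖ ^ 2) ^ n / normSq p j n := by
  rw [norm_mul, mul_pow, norm_pow, Complex.norm_real, norm_inv, inv_pow, Real.norm_eq_abs, sq_abs,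
    Real.sq_sqrt (normSq_pos hp j n).le, ← pow_mul, ← pow_mul, mul_comm 2]
  rfl

lemma summable_vertexTerm (hp : 1 < p) (hζ : IsZeroMode p j k ζ) (α : ℂ) :
    Summable (vertexTerm p ζ α) := by
  have h := (hζ.orthonormal_numberState hp).orthogonalFamily.summable_iff_norm_sq_summable
    (fun n => α ^ n * (((Real.sqrt (normSq p j n))⁻¹ : ℝ) : ℂ))
  simp_rw [norm_coef_sq hp] at h
  have h2 : Summable fun n => (‖α‖ ^ 2) ^ n / normSq p j n := by
    refine Summable.of_nonneg_of_le (fun n => div_nonneg (by positivity) (normSq_pos hp j n).le)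
      (fun n => ?_) (Real.summable_pow_div_factorial (‖α‖ ^ 2))
    have := normSq_ge hp j n
    gcongr
  have h3 := h.2 h2
  have h4 : vertexTerm p ζ α = fun n =>
      (α ^ n * (((Real.sqrt (normSq p j n))⁻¹ : ℝ) : ℂ)) • numberState p j ζ n :=
    funext fun n => hζ.vertexTerm_eq hp α n
  rw [h4]
  simpa using h3

lemma cohRaw_mem (hp : 1 < p) (hζ : IsZeroMode p j k ζ) (α : ℂ) :
    cohRaw p ζ α ∈ cyclicSubspace p ζ := by
  refine (Submodule.isClosed_topologicalClosure _).mem_of_tendsto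
    (hζ.summable_vertexTerm hp α).hasSum (Filter.Eventually.of_forall fun s => ?_)
  refine Submodule.sum_mem _ fun n _ => ?_
  rw [hζ.vertexTerm_eq hp]
  exact Submodule.smul_mem _ _ (numberState_mem n)

lemma inner_cohRaw (hp : 1 < p) (hζ : IsZeroMode p j k ζ) (α : ℂ) (n : ℕ) :
    inner ℂ (numberState p j ζ n) (cohRaw p ζ α) =
      α ^ n * (((Real.sqrt (normSq p j n))⁻¹ : ℝ) : ℂ) := by
  classical
  have h1 := (hζ.summable_vertexTerm hp α).hasSum.mapL (innerSL ℂ (numberState p j ζ n))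
  change HasSum _ (inner ℂ (numberState p j ζ n) (cohRaw p ζ α)) at h1
  simp only [innerSL_apply_apply, hζ.vertexTerm_eq hp, inner_smul_right,
    orthonormal_iff_ite.1 (hζ.orthonormal_numberState hp)] at h1
  rw [h1.unique (hasSum_single n (fun m hm => by simp [hm.symm]))]
  simp

end IsZeroMode

/-- The even part of the unnormalized coherent state. -/
def cohEven (p : ℝ) (ζ : FinVec) (α : ℂ) : Fock :=
  (2⁻¹ : ℂ) • (cohRaw p ζ α + cohRaw p ζ (-α))

/-- The odd part of the unnormalized coherent state. -/
def cohOdd (p : ℝ) (ζ : FinVec) (α : ℂ) : Fock :=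
  (2⁻¹ : ℂ) • (cohRaw p ζ α - cohRaw p ζ (-α))

lemma cohRaw_eq_add (p : ℝ) (ζ : FinVec) (α : ℂ) :
    cohRaw p ζ α = cohEven p ζ α + cohOdd p ζ α := by
  unfold cohEven cohOdd; module

lemma cohRaw_neg_eq_sub (p : ℝ) (ζ : FinVec) (α : ℂ) :
    cohRaw p ζ (-α) = cohEven p ζ α - cohOdd p ζ α := by
  unfold cohEven cohOdd; module

namespace IsZeroMode

variable {p : ℝ} {j k : ℕ} {ζ : FinVec}

lemma cohEven_mem (hp : 1 < p) (hζ : IsZeroMode p j k ζ) (α : ℂ) :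
    cohEven p ζ α ∈ cyclicSubspace p ζ :=
  Submodule.smul_mem _ _ (Submodule.add_mem _ (hζ.cohRaw_mem hp α) (hζ.cohRaw_mem hp (-α)))

lemma cohOdd_mem (hp : 1 < p) (hζ : IsZeroMode p j k ζ) (α : ℂ) :
    cohOdd p ζ α ∈ cyclicSubspace p ζ :=
  Submodule.smul_mem _ _ (Submodule.sub_mem _ (hζ.cohRaw_mem hp α) (hζ.cohRaw_mem hp (-α)))

lemma inner_cohEven (hp : 1 < p) (hζ : IsZeroMode p j k ζ) (α : ℂ) (n : ℕ) :
    inner ℂ (numberState p j ζ n) (cohEven p ζ α) =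
      if Even n then α ^ n * (((Real.sqrt (normSq p j n))⁻¹ : ℝ) : ℂ) else 0 := by
  rw [cohEven, inner_smul_right, inner_add_right, hζ.inner_cohRaw hp, hζ.inner_cohRaw hp]
  split_ifs with h
  · rw [h.neg_pow]; ring
  · rw [(Nat.not_even_iff_odd.1 h).neg_pow]; ring

lemma inner_cohOdd (hp : 1 < p) (hζ : IsZeroMode p j k ζ) (α : ℂ) (n : ℕ) :
    inner ℂ (numberState p j ζ n) (cohOdd p ζ α) =
      if Even n then 0 else α ^ n * (((Real.sqrt (normSq p j n))⁻¹ : ℝ) : ℂ) := by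
  rw [cohOdd, inner_smul_right, inner_sub_right, hζ.inner_cohRaw hp, hζ.inner_cohRaw hp]
  split_ifs with h
  · rw [h.neg_pow]; ring
  · rw [(Nat.not_even_iff_odd.1 h).neg_pow]; ring

lemma hasSum_norm_cohRaw (hp : 1 < p) (hζ : IsZeroMode p j k ζ) (α : ℂ) :
    HasSum (fun n => (‖α‖ ^ 2) ^ n / normSq p j n) (‖cohRaw p ζ α‖ ^ 2) := by
  have := hζ.hasSum_norm_sq hp (hζ.cohRaw_mem hp α)
  simpa only [hζ.inner_cohRaw hp, norm_coef_sq hp] using this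

lemma hasSum_norm_cohEven (hp : 1 < p) (hζ : IsZeroMode p j k ζ) (α : ℂ) :
    HasSum (fun m => (‖α‖ ^ 2) ^ (2 * m) / normSq p j (2 * m)) (‖cohEven p ζ α‖ ^ 2) := by
  have h := hζ.hasSum_norm_sq hp (hζ.cohEven_mem hp α)
  have hinj : Function.Injective (fun m : ℕ => 2 * m) := fun a b h => by
    dsimp only at h; omega
  rw [← hinj.hasSum_iff] at h
  · convert h using 1
    ext m
    rw [Function.comp_apply, hζ.inner_cohEven hp, if_pos (even_two_mul m), norm_coef_sq hp]
  · intro n hn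
    have : ¬ Even n := fun ⟨m, hm⟩ => hn ⟨m, by dsimp only; omega⟩
    rw [hζ.inner_cohEven hp, if_neg this]
    simp

lemma hasSum_norm_cohOdd (hp : 1 < p) (hζ : IsZeroMode p j k ζ) (α : ℂ) :
    HasSum (fun m => (‖α‖ ^ 2) ^ (2 * m + 1) / normSq p j (2 * m + 1)) (‖cohOdd p ζ α‖ ^ 2) := by
  have h := hζ.hasSum_norm_sq hp (hζ.cohOdd_mem hp α)
  have hinj : Function.Injective (fun m : ℕ => 2 * m + 1) := fun a b h => by
    dsimp only at h; omega
  rw [← hinj.hasSum_iff] at h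
  · convert h using 1
    ext m
    rw [Function.comp_apply, hζ.inner_cohOdd hp, if_neg (by simp), norm_coef_sq hp]
  · intro n hn
    have : Even n := by
      by_contra h
      obtain ⟨m, hm⟩ := Nat.not_even_iff_odd.1 h
      exact hn ⟨m, hm.symm⟩
    rw [hζ.inner_cohOdd hp, if_pos this]
    simp

/-- The power series of the squared norm splits into its even and odd terms. -/
lemma norm_cohRaw_sq (hp : 1 < p) (hζ : IsZeroMode p j k ζ) (α : ℂ) :
    ‖cohRaw p ζ α‖ ^ 2 = ‖cohEven p ζ α‖ ^ 2 + ‖cohOdd p ζ α‖ ^ 2 :=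
  (hζ.hasSum_norm_cohRaw hp α).unique
    (HasSum.even_add_odd (hζ.hasSum_norm_cohEven hp α) (hζ.hasSum_norm_cohOdd hp α))

lemma norm_cohRaw_neg (hp : 1 < p) (hζ : IsZeroMode p j k ζ) (α : ℂ) :
    ‖cohRaw p ζ (-α)‖ = ‖cohRaw p ζ α‖ := by
  have h := hζ.hasSum_norm_cohRaw hp (-α)
  rw [norm_neg] at h
  have := h.unique (hζ.hasSum_norm_cohRaw hp α)
  exact (sq_eq_sq₀ (norm_nonneg _) (norm_nonneg _)).1 this

lemma cohEven_ne_zero (hp : 1 < p) (hζ : IsZeroMode p j k ζ) (α : ℂ) : cohEven p ζ α ≠ 0 := by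
  intro h
  have := hζ.inner_cohEven hp α 0
  rw [h] at this
  simp [normSq_zero] at this

lemma cohOdd_ne_zero (hp : 1 < p) (hζ : IsZeroMode p j k ζ) {α : ℂ} (hα : α ≠ 0) :
    cohOdd p ζ α ≠ 0 := by
  intro h
  have := hζ.inner_cohOdd hp α 1
  rw [h, inner_zero_right, if_neg Nat.not_even_one, pow_one] at this
  refine mul_ne_zero hα ?_ this.symm
  exact_mod_cast (inv_pos.2 (Real.sqrt_pos.2 (normSq_pos hp j 1))).ne'

lemma cohRaw_ne_zero (hp : 1 < p) (hζ : IsZeroMode p j k ζ) (α : ℂ) : cohRaw p ζ α ≠ 0 := by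
  intro h
  have := hζ.inner_cohRaw hp α 0
  rw [h] at this
  simp [normSq_zero] at this

end IsZeroMode

lemma norm_inv_norm_smul {x : Fock} (hx : x ≠ 0) : ‖((‖x‖⁻¹ : ℝ) : ℂ) • x‖ = 1 := by
  rw [norm_smul, Complex.norm_real, norm_inv, norm_norm, inv_mul_cancel₀ (norm_ne_zero_iff.2 hx)]

lemma inv_norm_smul_smul {t : ℝ} (ht : 0 < t) (x : Fock) :
    ((‖(t : ℂ) • x‖⁻¹ : ℝ) : ℂ) • ((t : ℂ) • x) = ((‖x‖⁻¹ : ℝ) : ℂ) • x := by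
  rw [smul_smul, ← Complex.ofReal_mul, norm_smul, Complex.norm_real, Real.norm_of_nonneg ht.le,
    mul_inv, mul_right_comm, inv_mul_cancel₀ ht.ne', one_mul]

namespace IsZeroMode

variable {p : ℝ} {j k : ℕ} {ζ : FinVec}

/-- As ‖χ(-α)ζ‖ = ‖χ(α)ζ‖, the sum of the normalized states is a positive multiple of the even part,
and the multiple disappears on normalizing. -/
lemma catPlus_eq (hp : 1 < p) (hζ : IsZeroMode p j k ζ) (α : ℂ) :
    catPlus p ζ α = ((‖cohEven p ζ α‖⁻¹ : ℝ) : ℂ) • cohEven p ζ α := by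
  have h : coh p ζ α + coh p ζ (-α) = ((2 * ‖cohRaw p ζ α‖⁻¹ : ℝ) : ℂ) • cohEven p ζ α := by
    rw [coh, coh, hζ.norm_cohRaw_neg hp, cohEven]
    push_cast
    module
  have hpos := norm_pos_iff.2 (hζ.cohRaw_ne_zero hp α)
  rw [catPlus, h, inv_norm_smul_smul (by positivity)]

lemma catMinus_eq (hp : 1 < p) (hζ : IsZeroMode p j k ζ) (α : ℂ) :
    catMinus p ζ α = ((‖cohOdd p ζ α‖⁻¹ : ℝ) : ℂ) • cohOdd p ζ α := by
  have h : coh p ζ α - coh p ζ (-α) = ((2 * ‖cohRaw p ζ α‖⁻¹ : ℝ) : ℂ) • cohOdd p ζ α := by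
    rw [coh, coh, hζ.norm_cohRaw_neg hp, cohOdd]
    push_cast
    module
  have hpos := norm_pos_iff.2 (hζ.cohRaw_ne_zero hp α)
  rw [catMinus, h, inv_norm_smul_smul (by positivity)]

end IsZeroMode

/-! ### Norms of the coherent states and Bessel functions -/

/-- The order of the Bessel function attached to the even part. -/
def order (p : ℝ) (j : ℕ) : ℝ := p / 2 + j - 1

lemma order_gt {p : ℝ} (hp : 1 < p) (j : ℕ) : -(1 / 2) < order p j := by
  have : (0 : ℝ) ≤ j := j.cast_nonneg
  unfold order
  linarith

lemma Gamma_add_nat {a : ℝ} (ha : 0 < a) (m : ℕ) :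
    Real.Gamma (a + m) = Real.Gamma a * ∏ i ∈ Finset.range m, (a + i) := by
  induction m with
  | zero => simp
  | succ m ih =>
    rw [Finset.prod_range_succ, ← mul_assoc, ← ih, Nat.cast_succ, ← add_assoc,
      Real.Gamma_add_one (by positivity), mul_comm]

lemma normSq_even {p : ℝ} (hp : 1 < p) (j m : ℕ) : normSq p j (2 * m) =
    2 ^ (2 * m) * m.factorial * Real.Gamma (order p j + m + 1) / Real.Gamma (order p j + 1) := by
  have ha := order_gt hp j
  have hG := (Real.Gamma_pos_of_pos (show 0 < order p j + 1 by linarith)).ne'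
  have h1 : 2 * m / 2 = m := by omega
  have h2 : (2 * m + 1) / 2 = m := by omega
  rw [add_right_comm, Gamma_add_nat (by linarith), normSq, h1, h2, order]
  rw [order] at hG
  rw [sub_add_cancel] at *
  field_simp

lemma normSq_odd {p : ℝ} (hp : 1 < p) (j m : ℕ) : normSq p j (2 * m + 1) =
    2 ^ (2 * m + 1) * m.factorial * Real.Gamma (order p j + 1 + m + 1) /
      Real.Gamma (order p j + 1) := by
  have ha := order_gt hp j
  have hG := (Real.Gamma_pos_of_pos (show 0 < order p j + 1 by linarith)).ne'
  have h1 : (2 * m + 1) / 2 = m := by omega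
  have h2 : (2 * m + 1 + 1) / 2 = m + 1 := by omega
  have := Gamma_add_nat (show 0 < order p j + 1 by linarith) (m + 1)
  rw [Nat.cast_succ, ← add_assoc] at this
  rw [this, normSq, h1, h2, order]
  rw [order] at hG
  rw [sub_add_cancel] at *
  field_simp

/-- Ratio of `I_ν(r)` to the squared norm of the even part of the coherent state. -/
def besselRatio (ν r : ℝ) : ℝ := (r / 2) ^ ν / Real.Gamma (ν + 1)

lemma besselRatio_pos {p : ℝ} (hp : 1 < p) (j : ℕ) {r : ℝ} (hr : 0 < r) :
    0 < besselRatio (order p j) r := by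
  have ha := order_gt hp j
  have := Real.Gamma_pos_of_pos (show 0 < order p j + 1 by linarith)
  unfold besselRatio
  positivity

namespace IsZeroMode

variable {p : ℝ} {j k : ℕ} {ζ : FinVec}

/-- Since p/2 + j = ν + 1, the rising factorial in N_{2m} is Γ(ν+m+1)/Γ(ν+1), so the two power
series agree term by term up to the prefactor. -/
lemma besselI_order (hp : 1 < p) (hζ : IsZeroMode p j k ζ) {α : ℂ} (hα : α ≠ 0) :
    besselI (order p j) (‖α‖ ^ 2) =
      besselRatio (order p j) (‖α‖ ^ 2) * ‖cohEven p ζ α‖ ^ 2 := by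
  have hr : 0 < ‖α‖ ^ 2 := by positivity
  rw [besselI, ← ((hζ.hasSum_norm_cohEven hp α).mul_left _).tsum_eq]
  refine tsum_congr fun m => ?_
  have ha := order_gt hp j
  have hm : (0 : ℝ) ≤ m := m.cast_nonneg
  have h1 := (Real.Gamma_pos_of_pos (show 0 < order p j + 1 by linarith)).ne'
  have h2 := (Real.Gamma_pos_of_pos (show 0 < order p j + m + 1 by linarith)).ne'
  rw [normSq_even hp, besselRatio, Real.rpow_add (by positivity),
    show (2 * (m : ℝ)) = ((2 * m : ℕ) : ℝ) by push_cast; ring, Real.rpow_natCast, div_pow]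
  field_simp

lemma besselI_order_add_one (hp : 1 < p) (hζ : IsZeroMode p j k ζ) {α : ℂ} (hα : α ≠ 0) :
    besselI (order p j + 1) (‖α‖ ^ 2) =
      besselRatio (order p j) (‖α‖ ^ 2) * ‖cohOdd p ζ α‖ ^ 2 := by
  have hr : 0 < ‖α‖ ^ 2 := by positivity
  rw [besselI, ← ((hζ.hasSum_norm_cohOdd hp α).mul_left _).tsum_eq]
  refine tsum_congr fun m => ?_
  have ha := order_gt hp j
  have hm : (0 : ℝ) ≤ m := m.cast_nonneg
  have h1 := (Real.Gamma_pos_of_pos (show 0 < order p j + 1 by linarith)).ne'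
  have h2 := (Real.Gamma_pos_of_pos (show 0 < order p j + 1 + m + 1 by linarith)).ne'
  rw [normSq_odd hp, besselRatio, add_assoc, Real.rpow_add (by positivity),
    show (1 + 2 * (m : ℝ)) = ((2 * m + 1 : ℕ) : ℝ) by push_cast; ring, Real.rpow_natCast, div_pow]
  field_simp

end IsZeroMode

/-! ### Weak integrals of orthogonal expansions -/

section Weak

variable {Ω : Type*} [MeasurableSpace Ω] {μ : Measure Ω}

lemma L2_inner_toLp {f g : Ω → ℂ} (hf : MemLp f 2 μ) (hg : MemLp g 2 μ) :
    inner ℂ (hf.toLp f) (hg.toLp g) = ∫ ω, (inner ℂ (f ω) (g ω) : ℂ) ∂μ := by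
  rw [L2.inner_def]
  refine integral_congr_ae ?_
  filter_upwards [hf.coeFn_toLp, hg.coeFn_toLp] with ω h1 h2
  rw [h1, h2]

/-- A pointwise convergent expansion in orthogonal functions of bounded norm with square summable
coefficients also converges in `L²`. -/
lemma exists_memLp_hasSum {g : ℕ → Ω → ℂ} (hg : ∀ n, MemLp (g n) 2 μ)
    (horth : ∀ m n, m ≠ n → ∫ ω, (inner ℂ (g m ω) (g n ω) : ℂ) ∂μ = 0) {C : ℝ}
    (hC : ∀ n, ‖(hg n).toLp (g n)‖ ^ 2 ≤ C) {c : ℕ → ℂ} (hc : Summable fun n => ‖c n‖ ^ 2)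
    {G : Ω → ℂ} (hG : ∀ ω, HasSum (fun n => c n * g n ω) (G ω)) :
    ∃ h : MemLp G 2 μ, HasSum (fun n => c n • (hg n).toLp (g n)) (h.toLp G) := by
  have hfam : OrthogonalFamily ℂ (fun n => (ℂ ∙ (hg n).toLp (g n)))
      (fun n => (ℂ ∙ (hg n).toLp (g n)).subtypeₗᵢ) := by
    intro m n hmn x y
    obtain ⟨a, ha⟩ := Submodule.mem_span_singleton.1 x.2
    obtain ⟨b, hb⟩ := Submodule.mem_span_singleton.1 y.2
    simp only [Submodule.coe_subtypeₗᵢ, Submodule.subtype_apply]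
    rw [← ha, ← hb, inner_smul_left, inner_smul_right, L2_inner_toLp, horth m n hmn]
    simp
  have hsum : Summable (fun n => c n • (hg n).toLp (g n)) := by
    have h := hfam.summable_iff_norm_sq_summable
      (fun n => ⟨c n • (hg n).toLp (g n), Submodule.mem_span_singleton.2 ⟨_, rfl⟩⟩)
    simp only [Submodule.coe_subtypeₗᵢ, Submodule.subtype_apply, Submodule.coe_norm] at h
    refine h.2 (Summable.of_nonneg_of_le (fun n => by positivity) (fun n => ?_)
      (hc.mul_right C))
    rw [norm_smul, mul_pow]
    exact mul_le_mul_of_nonneg_left (hC n) (by positivity)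
  obtain ⟨F, hF⟩ := hsum
  have hae : ∀ N : ℕ, (∑ n ∈ Finset.range N, c n • (hg n).toLp (g n) : Lp ℂ 2 μ) =ᵐ[μ]
      fun ω => ∑ n ∈ Finset.range N, c n * g n ω := by
    intro N
    induction N with
    | zero =>
      simp only [Finset.range_zero, Finset.sum_empty]
      filter_upwards [Lp.coeFn_zero ℂ 2 μ] with ω h1
      rw [h1, Pi.zero_apply]
    | succ N ih =>
      simp only [Finset.sum_range_succ]
      filter_upwards [Lp.coeFn_add (∑ n ∈ Finset.range N, c n • (hg n).toLp (g n))
        (c N • (hg N).toLp (g N)), ih, Lp.coeFn_smul (c N) ((hg N).toLp (g N)),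
        (hg N).coeFn_toLp] with ω h1 h2 h3 h4
      rw [h1, Pi.add_apply, h2, h3, Pi.smul_apply, h4, smul_eq_mul]
  -- A subsequence of the L²-convergent partial sums converges almost everywhere, which identifies
  -- the L² limit with the pointwise sum G.
  obtain ⟨φ, hφ, hlim⟩ := (tendstoInMeasure_of_tendsto_Lp hF.tendsto_sum_nat).exists_seq_tendsto_ae
  have hFG : F =ᵐ[μ] G := by
    filter_upwards [hlim, ae_all_iff.2 hae] with ω h1 h2
    refine tendsto_nhds_unique h1 ?_
    simp only [h2]
    exact (hG ω).tendsto_sum_nat.comp hφ.tendsto_atTop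
  refine ⟨(Lp.memLp F).ae_eq hFG, ?_⟩
  have : ((Lp.memLp F).ae_eq hFG).toLp G = F := by
    refine Lp.ext ?_
    filter_upwards [((Lp.memLp F).ae_eq hFG).coeFn_toLp, hFG] with ω h1 h2
    rw [h1, h2]
  rwa [this]

/-- Termwise integration of the product of two orthogonal expansions. -/
lemma hasSum_integral_inner {g g' : ℕ → Ω → ℂ} (hg : ∀ n, MemLp (g n) 2 μ)
    (hg' : ∀ n, MemLp (g' n) 2 μ)
    (horth : ∀ m n, m ≠ n → ∫ ω, (inner ℂ (g m ω) (g n ω) : ℂ) ∂μ = 0)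
    (horth' : ∀ m n, m ≠ n → ∫ ω, (inner ℂ (g' m ω) (g' n ω) : ℂ) ∂μ = 0)
    (hcross : ∀ m n, m ≠ n → ∫ ω, (inner ℂ (g m ω) (g' n ω) : ℂ) ∂μ = 0) {C C' : ℝ}
    (hC : ∀ n, ‖(hg n).toLp (g n)‖ ^ 2 ≤ C) (hC' : ∀ n, ‖(hg' n).toLp (g' n)‖ ^ 2 ≤ C')
    {c c' : ℕ → ℂ} (hc : Summable fun n => ‖c n‖ ^ 2) (hc' : Summable fun n => ‖c' n‖ ^ 2)
    {G G' : Ω → ℂ} (hG : ∀ ω, HasSum (fun n => c n * g n ω) (G ω))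
    (hG' : ∀ ω, HasSum (fun n => c' n * g' n ω) (G' ω)) :
    Integrable (fun ω => (inner ℂ (G ω) (G' ω) : ℂ)) μ ∧
      HasSum (fun n => inner ℂ (c n) (c' n) * ∫ ω, (inner ℂ (g n ω) (g' n ω) : ℂ) ∂μ)
        (∫ ω, (inner ℂ (G ω) (G' ω) : ℂ) ∂μ) := by
  obtain ⟨h, hs⟩ := exists_memLp_hasSum hg horth hC hc hG
  obtain ⟨h', hs'⟩ := exists_memLp_hasSum hg' horth' hC' hc' hG'
  constructor
  · refine (L2.integrable_inner (𝕜 := ℂ) (h.toLp G) (h'.toLp G')).congr ?_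
    filter_upwards [h.coeFn_toLp, h'.coeFn_toLp] with ω h1 h2
    rw [h1, h2]
  · rw [← L2_inner_toLp h h']
    -- Pairing the expansion of G with one g'ₙ leaves a single term by `hcross`.
    have key : ∀ n, inner ℂ (h.toLp G) ((hg' n).toLp (g' n)) =
        (starRingEnd ℂ) (c n) * ∫ ω, (inner ℂ (g n ω) (g' n ω) : ℂ) ∂μ := by
      intro n
      have h1 := hs.mapL (innerSL ℂ ((hg' n).toLp (g' n)))
      simp only [innerSL_apply_apply, inner_smul_right] at h1
      have h2 := h1.unique (hasSum_single n fun m hm => by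
        rw [← inner_conj_symm, L2_inner_toLp, hcross m n hm, map_zero, mul_zero])
      rw [← inner_conj_symm, h2, map_mul, inner_conj_symm, L2_inner_toLp]
    have h1 := hs'.mapL (innerSL ℂ (h.toLp G))
    simp only [innerSL_apply_apply, inner_smul_right, key] at h1
    simpa only [RCLike.inner_apply, mul_assoc] using h1

end Weak

/-! ### Radial weights on the complex plane -/

lemma integral_d2α {E : Type*} [NormedAddCommGroup E] [NormedSpace ℝ E] (f : ℂ → E) :
    ∫ α, f α ∂d2α = (1 / (2 * Real.pi)) • ∫ α, f α := by
  rw [d2α, integral_smul_measure, ENNReal.toReal_ofReal (by positivity)]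

lemma integrable_d2α {E : Type*} [NormedAddCommGroup E] {f : ℂ → E} :
    Integrable f d2α ↔ Integrable f :=
  integrable_smul_measure
    (by simpa using by positivity) ENNReal.ofReal_ne_top

lemma ae_d2α_ne_zero : ∀ᵐ α ∂d2α, α ≠ 0 := by
  rw [d2α]
  refine Measure.ae_smul_measure ?_ _
  have : ({0}ᶜ : Set ℂ) ∈ ae (volume : Measure ℂ) := compl_mem_ae_iff.2 (by simp)
  exact this

lemma integrable_radial_iff {f : ℝ → ℝ} :
    Integrable (fun α : ℂ => f (‖α‖ ^ 2)) d2α ↔ IntegrableOn f (Set.Ioi 0) := by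
  rw [integrable_d2α, integrable_fun_norm_addHaar volume (f := fun r => f (r ^ 2)),
    ← integrableOn_Ioi_comp_rpow_iff' f (p := 2) two_ne_zero]
  refine integrableOn_congr_fun (fun x _ => ?_) measurableSet_Ioi
  norm_num

/-- The angle integrates to 1, and ρ dρ = dr/2 for r = ρ². -/
lemma integral_radial (f : ℝ → ℝ) :
    ∫ α : ℂ, f (‖α‖ ^ 2) ∂d2α = 2⁻¹ * ∫ r in Set.Ioi (0 : ℝ), f r := by
  rw [integral_d2α, integral_fun_norm_addHaar volume (fun r => f (r ^ 2)),
    ← integral_comp_rpow_Ioi_of_pos (g := f) (p := 2) two_pos]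
  have h : ∀ x : ℝ, (2 * x ^ ((2 : ℝ) - 1)) • f (x ^ (2 : ℝ)) = 2 * (x * f (x ^ 2)) := by
    intro x; norm_num; ring
  simp_rw [h, integral_const_mul]
  simp [Measure.real, Complex.volume_ball]
  field_simp

/-- Radial weights integrate different monomials to zero. -/
lemma integral_monomial_eq_zero (w : ℝ → ℂ) {m n : ℕ} (hmn : m ≠ n) :
    ∫ α : ℂ, w ‖α‖ * (α ^ m * (starRingEnd ℂ) α ^ n) ∂d2α = 0 := by
  rw [integral_d2α]
  -- Rotation by π/(m - n) multiplies αᵐᾱⁿ by exp(iπ) = -1 and preserves Lebesgue measure, so the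
  -- integral equals its negative.
  set c : Circle := Circle.exp (Real.pi / ((m : ℝ) - n)) with hc
  have hne : (m : ℝ) - n ≠ 0 := sub_ne_zero.2 (by exact_mod_cast hmn)
  have hcm : (c : ℂ) ^ m * (starRingEnd ℂ) (c : ℂ) ^ n = -1 := by
    rw [← Circle.coe_inv_eq_conj, hc, ← Circle.exp_neg, Circle.coe_exp, Circle.coe_exp,
      ← Complex.exp_nat_mul, ← Complex.exp_nat_mul, ← Complex.exp_add, ← Complex.exp_pi_mul_I]
    congr 1
    have : ((m : ℂ) - n) ≠ 0 := by exact_mod_cast hne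
    push_cast
    field_simp
    ring
  have key := (rotation c).measurePreserving.integral_comp
    (rotation c).toHomeomorph.measurableEmbedding
    (fun α : ℂ => w ‖α‖ * (α ^ m * (starRingEnd ℂ) α ^ n))
  have h2 : ∀ α : ℂ, w ‖rotation c α‖ * ((rotation c α) ^ m *
      (starRingEnd ℂ) (rotation c α) ^ n) = -(w ‖α‖ * (α ^ m * (starRingEnd ℂ) α ^ n)) := by
    intro α
    rw [LinearIsometryEquiv.norm_map, rotation_apply, map_mul, mul_pow, mul_pow]
    linear_combination (w ‖α‖ * (α ^ m * (starRingEnd ℂ) α ^ n)) * hcm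
  simp_rw [h2] at key
  rw [integral_neg, neg_eq_iff_add_eq_zero, ← two_mul] at key
  have := (mul_eq_zero.1 key).resolve_left two_ne_zero
  rw [this, smul_zero]

/-! ### Bessel weights and their moments -/

/-- The weight `2 r (r/2)^ν K_μ(r) / Γ(ν + 1)`. -/
def besselWeight (ν μ r : ℝ) : ℝ := 2 * r * besselRatio ν r * besselK μ r

/-- The moments of `besselWeight`. -/
def moment (ν μ : ℝ) (n : ℕ) : ℝ :=
  2 ^ n * Real.Gamma ((ν + n + 2 - μ) / 2) * Real.Gamma ((ν + n + 2 + μ) / 2) /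
    Real.Gamma (ν + 1)

lemma measurable_besselWeight (ν μ : ℝ) : Measurable (besselWeight ν μ) := by
  unfold besselWeight besselRatio
  exact ((measurable_id.const_mul 2).mul
    (((measurable_id.div_const 2).pow_const ν).div_const _)).mul (measurable_besselK μ)

lemma besselWeight_nonneg {ν : ℝ} (hν : -1 < ν) (μ : ℝ) {r : ℝ} (hr : 0 ≤ r) :
    0 ≤ besselWeight ν μ r := by
  have := Real.Gamma_pos_of_pos (show 0 < ν + 1 by linarith)
  have := besselK_nonneg μ r
  unfold besselWeight besselRatio
  positivity

lemma besselWeight_mul_pow (ν μ : ℝ) (n : ℕ) {r : ℝ} (hr : 0 < r) :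
    besselWeight ν μ r * r ^ n =
      (2 / (2 ^ ν * Real.Gamma (ν + 1))) * (r ^ (ν + n + 2 - 1) * besselK μ r) := by
  have : r ^ (ν + n + 2 - 1) = r ^ ν * r ^ n * r := by
    rw [show ν + n + 2 - 1 = ν + n + 1 by ring, Real.rpow_add_one hr.ne', Real.rpow_add hr,
      Real.rpow_natCast]
  rw [this, besselWeight, besselRatio, Real.div_rpow hr.le (by norm_num)]
  field_simp

lemma integrable_besselWeight {ν μ : ℝ} (n : ℕ) (h : |μ| < ν + n + 2) :
    Integrable (fun α : ℂ => besselWeight ν μ (‖α‖ ^ 2) * (‖α‖ ^ 2) ^ n) d2α := by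
  rw [integrable_radial_iff (f := fun r => besselWeight ν μ r * r ^ n)]
  refine IntegrableOn.congr_fun ((integrableOn_besselK_moment h).const_mul
    (2 / (2 ^ ν * Real.Gamma (ν + 1)))) (fun r hr => ?_) measurableSet_Ioi
  exact (besselWeight_mul_pow ν μ n hr).symm

lemma integral_besselWeight {ν μ : ℝ} (n : ℕ) (h : |μ| < ν + n + 2) :
    ∫ α : ℂ, besselWeight ν μ (‖α‖ ^ 2) * (‖α‖ ^ 2) ^ n ∂d2α = moment ν μ n := by
  rw [integral_radial (fun r => besselWeight ν μ r * r ^ n),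
    setIntegral_congr_fun measurableSet_Ioi (fun r hr => besselWeight_mul_pow ν μ n hr),
    integral_const_mul, integral_besselK_moment h, moment,
    show ν + n + 2 - 2 = ν + n by ring, Real.rpow_add two_pos, Real.rpow_natCast]
  have : (2 : ℝ) ^ ν ≠ 0 := by positivity
  field_simp

lemma abs_order_lt {p : ℝ} (hp : 1 < p) (j n : ℕ) : |order p j| < order p j + n + 2 := by
  have := order_gt hp j
  have hn : (0 : ℝ) ≤ n := n.cast_nonneg
  rw [abs_lt]; constructor <;> linarith

lemma abs_order_add_one_lt {p : ℝ} (hp : 1 < p) (j n : ℕ) :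
    |order p j + 1| < order p j + n + 2 := by
  have := order_gt hp j
  have hn : (0 : ℝ) ≤ n := n.cast_nonneg
  rw [abs_lt]; constructor <;> linarith

/-- For μ = ν and n = 2m the Gamma arguments are m + 1 and ν + m + 1, the factors of N_{2m}. The odd
case works in the same way with μ = ν + 1. -/
lemma moment_even {p : ℝ} (hp : 1 < p) (j m : ℕ) :
    moment (order p j) (order p j) (2 * m) = normSq p j (2 * m) := by
  rw [normSq_even hp, moment, ← Real.Gamma_nat_eq_factorial]
  push_cast
  ring_nf

lemma moment_odd {p : ℝ} (hp : 1 < p) (j m : ℕ) :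
    moment (order p j) (order p j + 1) (2 * m + 1) = normSq p j (2 * m + 1) := by
  rw [normSq_odd hp, moment, ← Real.Gamma_nat_eq_factorial]
  push_cast
  ring_nf

/-- K_μ increases with |μ|, and |ν| ≤ ν + 1 because ν > -1/2. -/
lemma moment_mono {p : ℝ} (hp : 1 < p) (j n : ℕ) :
    moment (order p j) (order p j) n ≤ moment (order p j) (order p j + 1) n := by
  have ha := order_gt hp j
  rw [← integral_besselWeight n (abs_order_lt hp j n),
    ← integral_besselWeight n (abs_order_add_one_lt hp j n)]
  refine integral_mono_ae (integrable_besselWeight n (abs_order_lt hp j n))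
    (integrable_besselWeight n (abs_order_add_one_lt hp j n)) ?_
  filter_upwards [ae_d2α_ne_zero] with α hα
  have hr : 0 < ‖α‖ ^ 2 := by positivity
  have hκ := besselRatio_pos hp j hr
  have hK : besselK (order p j) (‖α‖ ^ 2) ≤ besselK (order p j + 1) (‖α‖ ^ 2) := by
    refine besselK_le ?_ hr
    rw [abs_of_pos (show 0 < order p j + 1 by linarith), abs_le]
    constructor <;> linarith
  unfold besselWeight
  gcongr

/-- These wrong-parity moments have no closed match with N_{2m}; only boundedness of the quotient is
needed. It follows by comparing the growth factors from m to m + 1. -/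
lemma moment_even_le {p : ℝ} (hp : 1 < p) (j m : ℕ) :
    moment (order p j) (order p j + 1) (2 * m) ≤
      moment (order p j) (order p j + 1) 0 * normSq p j (2 * m) := by
  have ha := order_gt hp j
  set ν := order p j with hν
  have hG := Real.Gamma_pos_of_pos (show 0 < ν + 1 by linarith)
  induction m with
  | zero => simp [normSq_zero]
  | succ m ih =>
    have hm : (0 : ℝ) ≤ m := m.cast_nonneg
    have h1 : moment ν (ν + 1) (2 * (m + 1)) =
        4 * ((m + 1 / 2) * (ν + m + 3 / 2)) * moment ν (ν + 1) (2 * m) := by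
      unfold moment
      have e1 : (ν + (2 * (m + 1) : ℕ) + 2 - (ν + 1)) / 2 = ((m : ℝ) + 1 / 2) + 1 := by
        push_cast; ring
      have e2 : (ν + (2 * (m + 1) : ℕ) + 2 + (ν + 1)) / 2 = (ν + m + 3 / 2) + 1 := by
        push_cast; ring
      have e3 : (ν + (2 * m : ℕ) + 2 - (ν + 1)) / 2 = (m : ℝ) + 1 / 2 := by push_cast; ring
      have e4 : (ν + (2 * m : ℕ) + 2 + (ν + 1)) / 2 = ν + m + 3 / 2 := by push_cast; ring
      rw [e1, e2, e3, e4, Real.Gamma_add_one (by positivity),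
        Real.Gamma_add_one (show ν + m + 3 / 2 ≠ 0 by linarith), mul_add, pow_add]
      ring
    have h2 : normSq p j (2 * (m + 1)) = 4 * ((m + 1) * (ν + m + 1)) * normSq p j (2 * m) := by
      rw [show 2 * (m + 1) = 2 * m + 1 + 1 by ring, normSq_succ, normSq_succ, ladder, ladder,
        if_pos (by simp [parity_simps]), if_neg (by simp)]
      rw [hν, order]
      push_cast
      ring
    have h3 : 0 ≤ moment ν (ν + 1) (2 * m) := by
      have := Real.Gamma_pos_of_pos (show 0 < (ν + (2 * m : ℕ) + 2 - (ν + 1)) / 2 by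
        push_cast; linarith)
      have := Real.Gamma_pos_of_pos (show 0 < (ν + (2 * m : ℕ) + 2 + (ν + 1)) / 2 by
        push_cast; linarith)
      unfold moment
      positivity
    rw [h1, h2]
    calc 4 * ((m + 1 / 2) * (ν + m + 3 / 2)) * moment ν (ν + 1) (2 * m)
        ≤ 4 * ((m + 1) * (ν + m + 1)) * moment ν (ν + 1) (2 * m) := by
          refine mul_le_mul_of_nonneg_right ?_ h3
          -- The right product exceeds the left one by (ν + 1/2)/2, which is positive.
          nlinarith
      _ ≤ 4 * ((m + 1) * (ν + m + 1)) * (moment ν (ν + 1) 0 * normSq p j (2 * m)) := by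
          refine mul_le_mul_of_nonneg_left ih ?_
          have : 0 < ν + m + 1 := by linarith
          positivity
      _ = _ := by ring

/-- For odd n the moment equals Nₙ, and the constant is at least 1 because it dominates the zeroth
moment for K_ν, which is N₀ = 1. -/
lemma moment_add_one_le {p : ℝ} (hp : 1 < p) (j n : ℕ) :
    moment (order p j) (order p j + 1) n ≤
      moment (order p j) (order p j + 1) 0 * normSq p j n := by
  rcases Nat.even_or_odd' n with ⟨m, rfl | rfl⟩
  · exact moment_even_le hp j m
  · rw [moment_odd hp]
    have h1 := moment_mono hp j 0
    have h2 := moment_even hp j 0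
    rw [mul_zero, normSq_zero] at h2
    rw [h2] at h1
    exact le_mul_of_one_le_left (normSq_pos hp j _).le h1

/-! ### Weak integrals of radial families -/

/-- Components of `√w` times a family of vectors with components `xₙ αⁿ / √Nₙ`. -/
def radialFun (p : ℝ) (j : ℕ) (w : ℝ → ℝ) (x : ℕ → ℝ) (n : ℕ) (α : ℂ) : ℂ :=
  ((Real.sqrt (w (‖α‖ ^ 2)) * (x n * (Real.sqrt (normSq p j n))⁻¹) : ℝ) : ℂ) *
    (starRingEnd ℂ) α ^ n

section Radial

variable {p : ℝ} {j : ℕ} {w : ℝ → ℝ} {M : ℕ → ℝ}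

lemma norm_radialFun_sq (hp : 1 < p) (hw : ∀ r, 0 ≤ r → 0 ≤ w r) (x : ℕ → ℝ) (n : ℕ) (α : ℂ) :
    ‖radialFun p j w x n α‖ ^ 2 =
      (x n ^ 2 / normSq p j n) * (w (‖α‖ ^ 2) * (‖α‖ ^ 2) ^ n) := by
  rw [radialFun, norm_mul, mul_pow, Complex.norm_real, Real.norm_eq_abs, sq_abs, mul_pow, mul_pow,
    inv_pow, Real.sq_sqrt (hw _ (by positivity)), Real.sq_sqrt (normSq_pos hp j n).le, norm_pow,
    RCLike.norm_conj, ← pow_mul, ← pow_mul, mul_comm 2 n]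
  ring

lemma memLp_radialFun (hp : 1 < p) (hw : ∀ r, 0 ≤ r → 0 ≤ w r) (hwm : Measurable w)
    (hI : ∀ n : ℕ, Integrable (fun α : ℂ => w (‖α‖ ^ 2) * (‖α‖ ^ 2) ^ n) d2α) (x : ℕ → ℝ) (n : ℕ) :
    MemLp (radialFun p j w x n) 2 d2α := by
  have hm : AEStronglyMeasurable (radialFun p j w x n) d2α := by
    refine Measurable.aestronglyMeasurable (Measurable.mul ?_ (by fun_prop))
    have : Measurable fun α : ℂ => w (‖α‖ ^ 2) := hwm.comp (by fun_prop)
    fun_prop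
  rw [memLp_two_iff_integrable_sq_norm hm]
  simp_rw [norm_radialFun_sq hp hw]
  exact (hI n).const_mul _

lemma integral_inner_radialFun (hp : 1 < p) (hw : ∀ r, 0 ≤ r → 0 ≤ w r)
    (hM : ∀ n : ℕ, ∫ α : ℂ, w (‖α‖ ^ 2) * (‖α‖ ^ 2) ^ n ∂d2α = M n) (x y : ℕ → ℝ) (m n : ℕ) :
    ∫ α, (inner ℂ (radialFun p j w x m α) (radialFun p j w y n α) : ℂ) ∂d2α =
      if m = n then ((x n * y n * M n / normSq p j n : ℝ) : ℂ) else 0 := by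
  have h : ∀ α : ℂ, (inner ℂ (radialFun p j w x m α) (radialFun p j w y n α) : ℂ) =
      ((w (‖α‖ ^ 2) * (x m * (Real.sqrt (normSq p j m))⁻¹ *
        (y n * (Real.sqrt (normSq p j n))⁻¹)) : ℝ) : ℂ) *
        (α ^ m * (starRingEnd ℂ) α ^ n) := by
    intro α
    rw [RCLike.inner_apply, radialFun, radialFun, map_mul, Complex.conj_ofReal, map_pow,
      Complex.conj_conj]
    have : (((Real.sqrt (w (‖α‖ ^ 2)) : ℝ) : ℂ)) * ((Real.sqrt (w (‖α‖ ^ 2)) : ℝ) : ℂ) =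
        ((w (‖α‖ ^ 2) : ℝ) : ℂ) := by
      rw [← Complex.ofReal_mul, Real.mul_self_sqrt (hw _ (by positivity))]
    push_cast
    rw [← this]
    ring
  simp_rw [h]
  split_ifs with hmn
  · subst hmn
    have h2 : ∀ α : ℂ, ((w (‖α‖ ^ 2) * (x m * (Real.sqrt (normSq p j m))⁻¹ *
        (y m * (Real.sqrt (normSq p j m))⁻¹)) : ℝ) : ℂ) * (α ^ m * (starRingEnd ℂ) α ^ m) =
        (((x m * y m / normSq p j m) * (w (‖α‖ ^ 2) * (‖α‖ ^ 2) ^ m) : ℝ) : ℂ) := by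
      intro α
      rw [← mul_pow, Complex.mul_conj, Complex.normSq_eq_norm_sq]
      have := Real.mul_self_sqrt (normSq_pos hp j m).le
      rw [← Complex.ofReal_pow, ← Complex.ofReal_mul]
      congr 1
      have e : (Real.sqrt (normSq p j m))⁻¹ * (Real.sqrt (normSq p j m))⁻¹ =
          (normSq p j m)⁻¹ := by rw [← mul_inv, this]
      linear_combination (w (‖α‖ ^ 2) * x m * y m * (‖α‖ ^ 2) ^ m) * e
    simp_rw [h2]
    rw [integral_complex_ofReal, integral_const_mul, hM]
    congr 1
    ring
  · exact integral_monomial_eq_zero (fun r => ((w (r ^ 2) * (x m * (Real.sqrt (normSq p j m))⁻¹ *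
        (y n * (Real.sqrt (normSq p j n))⁻¹)) : ℝ) : ℂ)) hmn

end Radial

/-- Matrix elements of `∫ w |X(α)⟩⟨Y(α)| d²α` for radial `w` and vectors `X(α)`, `Y(α)` with
components `xₙ αⁿ / √Nₙ` and `yₙ αⁿ / √Nₙ`. -/
lemma IsZeroMode.hasSum_integral_radial {p : ℝ} {j k : ℕ} {ζ : FinVec} (hp : 1 < p)
    (hζ : IsZeroMode p j k ζ) {w : ℝ → ℝ} {M : ℕ → ℝ}
    (hw : ∀ r, 0 ≤ r → 0 ≤ w r) (hwm : Measurable w)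
    (hI : ∀ n : ℕ, Integrable (fun α : ℂ => w (‖α‖ ^ 2) * (‖α‖ ^ 2) ^ n) d2α)
    (hM : ∀ n : ℕ, ∫ α : ℂ, w (‖α‖ ^ 2) * (‖α‖ ^ 2) ^ n ∂d2α = M n)
    {C : ℝ} (hMC : ∀ n, M n ≤ C * normSq p j n) {x y : ℕ → ℝ}
    (hx : ∀ n, x n ^ 2 ≤ 1) (hy : ∀ n, y n ^ 2 ≤ 1) {X Y : ℂ → Fock}
    (hX : ∀ n α, inner ℂ (numberState p j ζ n) (X α) =
      (x n : ℂ) * (α ^ n * (((Real.sqrt (normSq p j n))⁻¹ : ℝ) : ℂ)))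
    (hY : ∀ n α, inner ℂ (numberState p j ζ n) (Y α) =
      (y n : ℂ) * (α ^ n * (((Real.sqrt (normSq p j n))⁻¹ : ℝ) : ℂ)))
    {u v : Fock} (hu : u ∈ cyclicSubspace p ζ) (hv : v ∈ cyclicSubspace p ζ) :
    Integrable (fun α => ((w (‖α‖ ^ 2) : ℝ) : ℂ) * (inner ℂ u (X α) * inner ℂ (Y α) v)) d2α ∧
      HasSum (fun n => inner ℂ (numberState p j ζ n) v * inner ℂ u (numberState p j ζ n) *
          ((x n * y n * M n / normSq p j n : ℝ) : ℂ))
        (∫ α, ((w (‖α‖ ^ 2) : ℝ) : ℂ) * (inner ℂ u (X α) * inner ℂ (Y α) v) ∂d2α) := by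
  have hMnn : ∀ n, 0 ≤ M n := fun n => by
    rw [← hM n]
    exact integral_nonneg fun α => mul_nonneg (hw _ (by positivity)) (by positivity)
  have hnorm : ∀ z : ℕ → ℝ, (∀ n, z n ^ 2 ≤ 1) → ∀ n,
      ‖(memLp_radialFun (j := j) hp hw hwm hI z n).toLp (radialFun p j w z n)‖ ^ 2 ≤ C := by
    intro z hz n
    have hN := normSq_pos hp j n
    have h1 := L2_inner_toLp (memLp_radialFun (j := j) hp hw hwm hI z n)
      (memLp_radialFun (j := j) hp hw hwm hI z n)
    rw [inner_self_eq_norm_sq_to_K, integral_inner_radialFun hp hw hM, if_pos rfl] at h1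
    have h2 : ‖(memLp_radialFun (j := j) hp hw hwm hI z n).toLp (radialFun p j w z n)‖ ^ 2 =
        z n * z n * M n / normSq p j n := by
      apply Complex.ofReal_injective
      rw [← h1]
      simp
    rw [h2, div_le_iff₀ hN]
    have h3 : z n * z n ≤ 1 := by have := hz n; rwa [sq] at this
    exact (mul_le_of_le_one_left (hMnn n) h3).trans (hMC n)
  -- The weight is shared as √w·√w between the two factors, so that each is an L² function; the
  -- conjugate monomials in `radialFun` arise since Z(α) stands in the conjugate-linear slot.
  have hexp : ∀ (z : ℕ → ℝ) (Z : ℂ → Fock), (∀ n α, inner ℂ (numberState p j ζ n) (Z α) =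
      (z n : ℂ) * (α ^ n * (((Real.sqrt (normSq p j n))⁻¹ : ℝ) : ℂ))) →
      ∀ t ∈ cyclicSubspace p ζ, ∀ α, HasSum
        (fun n => inner ℂ (numberState p j ζ n) t * radialFun p j w z n α)
        (((Real.sqrt (w (‖α‖ ^ 2)) : ℝ) : ℂ) * inner ℂ (Z α) t) := by
    intro z Z hZ t ht α
    have h1 := (hζ.hasSum_inner hp (Z α) ht).mul_left ((Real.sqrt (w (‖α‖ ^ 2)) : ℝ) : ℂ)
    refine h1.congr_fun ?_
    intro n
    rw [← inner_conj_symm (Z α), hZ, radialFun]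
    simp only [map_mul, map_pow, Complex.conj_ofReal]
    push_cast
    ring
  have horth : ∀ (z z' : ℕ → ℝ) (m n : ℕ), m ≠ n →
      ∫ α, (inner ℂ (radialFun p j w z m α) (radialFun p j w z' n α) : ℂ) ∂d2α = 0 :=
    fun z z' m n hmn => by rw [integral_inner_radialFun hp hw hM, if_neg hmn]
  have hfin := hasSum_integral_inner (memLp_radialFun (j := j) hp hw hwm hI x)
    (memLp_radialFun (j := j) hp hw hwm hI y) (horth x x) (horth y y) (horth x y)
    (hnorm x hx) (hnorm y hy) (hζ.hasSum_norm_sq hp hu).summable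
    (hζ.hasSum_norm_sq hp hv).summable (hexp x X hX u hu) (hexp y Y hY v hv)
  have hpt : ∀ α, (inner ℂ (((Real.sqrt (w (‖α‖ ^ 2)) : ℝ) : ℂ) * inner ℂ (X α) u)
      (((Real.sqrt (w (‖α‖ ^ 2)) : ℝ) : ℂ) * inner ℂ (Y α) v) : ℂ) =
      ((w (‖α‖ ^ 2) : ℝ) : ℂ) * (inner ℂ u (X α) * inner ℂ (Y α) v) := by
    intro α
    have : ((Real.sqrt (w (‖α‖ ^ 2)) : ℝ) : ℂ) * ((Real.sqrt (w (‖α‖ ^ 2)) : ℝ) : ℂ) =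
        ((w (‖α‖ ^ 2) : ℝ) : ℂ) := by
      rw [← Complex.ofReal_mul, Real.mul_self_sqrt (hw _ (by positivity))]
    rw [RCLike.inner_apply, map_mul, Complex.conj_ofReal, inner_conj_symm, ← this]
    ring
  simp_rw [hpt, integral_inner_radialFun hp hw hM, if_true, RCLike.inner_apply,
    inner_conj_symm] at hfin
  exact hfin

/-! ### Decompositions of unity -/

lemma inner_ketBra (u v x y : Fock) :
    (inner ℂ u (ketBra x y v) : ℂ) = inner ℂ u x * inner ℂ y v := by
  rw [ketBra, InnerProductSpace.rankOne_apply, inner_smul_right, mul_comm]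

/-- Indicator of the even numbers. -/
def evenMask (n : ℕ) : ℝ := if Even n then 1 else 0

/-- Indicator of the odd numbers. -/
def oddMask (n : ℕ) : ℝ := if Even n then 0 else 1

lemma evenMask_sq_le (n : ℕ) : evenMask n ^ 2 ≤ 1 := by
  unfold evenMask; split_ifs <;> norm_num

lemma oddMask_sq_le (n : ℕ) : oddMask n ^ 2 ≤ 1 := by
  unfold oddMask; split_ifs <;> norm_num

lemma evenMask_mul_moment {p : ℝ} (hp : 1 < p) (j n : ℕ) :
    evenMask n * moment (order p j) (order p j) n / normSq p j n = evenMask n := by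
  unfold evenMask
  split_ifs with h
  · obtain ⟨m, rfl⟩ := h
    rw [← two_mul, moment_even hp, one_mul, div_self (normSq_pos hp j _).ne']
  · simp

lemma oddMask_mul_moment {p : ℝ} (hp : 1 < p) (j n : ℕ) :
    oddMask n * moment (order p j) (order p j + 1) n / normSq p j n = oddMask n := by
  unfold oddMask
  split_ifs with h
  · simp
  · obtain ⟨m, rfl⟩ := Nat.not_even_iff_odd.1 h
    rw [moment_odd hp, one_mul, div_self (normSq_pos hp j _).ne']

lemma evenMask_add_oddMask (n : ℕ) : evenMask n + oddMask n = 1 := by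
  unfold evenMask oddMask; split_ifs <;> norm_num

namespace IsZeroMode

variable {p : ℝ} {j k : ℕ} {ζ : FinVec}

/-- The two halves, with weights built from `K_ν` and `K_{ν+1}`, of a resolution of the identity. -/
lemma integral_two_weights (hp : 1 < p) (hζ : IsZeroMode p j k ζ) {x x' : ℕ → ℝ}
    (hx : ∀ n, x n ^ 2 ≤ 1) (hx' : ∀ n, x' n ^ 2 ≤ 1)
    (hxe : ∀ n, x n * evenMask n = evenMask n) (hxo : ∀ n, x' n * oddMask n = oddMask n)
    {X X' : ℂ → Fock}
    (hX : ∀ n α, inner ℂ (numberState p j ζ n) (X α) =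
      (x n : ℂ) * (α ^ n * (((Real.sqrt (normSq p j n))⁻¹ : ℝ) : ℂ)))
    (hX' : ∀ n α, inner ℂ (numberState p j ζ n) (X' α) =
      (x' n : ℂ) * (α ^ n * (((Real.sqrt (normSq p j n))⁻¹ : ℝ) : ℂ)))
    {u v : Fock} (hu : u ∈ cyclicSubspace p ζ) (hv : v ∈ cyclicSubspace p ζ) :
    Integrable (fun α =>
      ((besselWeight (order p j) (order p j) (‖α‖ ^ 2) : ℝ) : ℂ) *
          (inner ℂ u (X α) * inner ℂ (cohEven p ζ α) v) +
        ((besselWeight (order p j) (order p j + 1) (‖α‖ ^ 2) : ℝ) : ℂ) *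
          (inner ℂ u (X' α) * inner ℂ (cohOdd p ζ α) v)) d2α ∧
    ∫ α, (((besselWeight (order p j) (order p j) (‖α‖ ^ 2) : ℝ) : ℂ) *
          (inner ℂ u (X α) * inner ℂ (cohEven p ζ α) v) +
        ((besselWeight (order p j) (order p j + 1) (‖α‖ ^ 2) : ℝ) : ℂ) *
          (inner ℂ u (X' α) * inner ℂ (cohOdd p ζ α) v)) ∂d2α = inner ℂ u v := by
  have ha := order_gt hp j
  have hE : ∀ n α, inner ℂ (numberState p j ζ n) (cohEven p ζ α) =
      (evenMask n : ℂ) * (α ^ n * (((Real.sqrt (normSq p j n))⁻¹ : ℝ) : ℂ)) := fun n α => by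
    rw [hζ.inner_cohEven hp, evenMask]; split_ifs <;> simp
  have hO : ∀ n α, inner ℂ (numberState p j ζ n) (cohOdd p ζ α) =
      (oddMask n : ℂ) * (α ^ n * (((Real.sqrt (normSq p j n))⁻¹ : ℝ) : ℂ)) := fun n α => by
    rw [hζ.inner_cohOdd hp, oddMask]; split_ifs <;> simp
  obtain ⟨i1, s1⟩ := hζ.hasSum_integral_radial hp
    (fun r => besselWeight_nonneg (by linarith) (order p j)) (measurable_besselWeight _ _)
    (fun n => integrable_besselWeight n (abs_order_lt hp j n))
    (fun n => integral_besselWeight n (abs_order_lt hp j n))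
    -- The bound is needed for odd n too: X may have odd components although it is paired with the
    -- even part.
    (fun n => (moment_mono hp j n).trans (moment_add_one_le hp j n)) hx evenMask_sq_le hX hE hu hv
  obtain ⟨i2, s2⟩ := hζ.hasSum_integral_radial hp
    (fun r => besselWeight_nonneg (by linarith) (order p j + 1)) (measurable_besselWeight _ _)
    (fun n => integrable_besselWeight n (abs_order_add_one_lt hp j n))
    (fun n => integral_besselWeight n (abs_order_add_one_lt hp j n))
    (fun n => moment_add_one_le hp j n) hx' oddMask_sq_le hX' hO hu hv
  refine ⟨i1.add i2, ?_⟩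
  rw [integral_add i1 i2]
  refine (s1.add s2).unique ((hζ.hasSum_inner hp u hv).congr_fun ?_)
  intro n
  rw [← mul_add, ← Complex.ofReal_add, hxe, hxo, evenMask_mul_moment hp, oddMask_mul_moment hp,
    evenMask_add_oddMask, Complex.ofReal_one, mul_one]

/-- Writing e and o for the parity parts, (K_ν + K_{ν+1})(e + o) + (K_ν - K_{ν+1})(e - o) = 2(K_ν e
+ K_{ν+1} o) in the bra. The sum of the I-factors cancels ‖χ(α)ζ‖², leaving the two weights of
`integral_two_weights` with the full coherent state as ket. -/
theorem integralIsIdentityOn_coh (hp : 1 < p) (hζ : IsZeroMode p j k ζ) :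
    IntegralIsIdentityOn (cyclicSubspace p ζ) d2α (fun α =>
      ((‖α‖ ^ 2 * (besselI (order p j) (‖α‖ ^ 2) + besselI (order p j + 1) (‖α‖ ^ 2)) : ℝ) : ℂ) •
        (((besselK (order p j) (‖α‖ ^ 2) + besselK (order p j + 1) (‖α‖ ^ 2) : ℝ) : ℂ) •
            ketBra (coh p ζ α) (coh p ζ α)
          + ((besselK (order p j) (‖α‖ ^ 2) - besselK (order p j + 1) (‖α‖ ^ 2) : ℝ) : ℂ) •
            ketBra (coh p ζ α) (coh p ζ (-α)))) := by
  intro u hu v hv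
  have hR : ∀ n α, inner ℂ (numberState p j ζ n) (cohRaw p ζ α) =
      (((fun _ => 1 : ℕ → ℝ) n : ℝ) : ℂ) *
        (α ^ n * (((Real.sqrt (normSq p j n))⁻¹ : ℝ) : ℂ)) := fun n α => by
    rw [hζ.inner_cohRaw hp]; simp
  have H := hζ.integral_two_weights hp (x := fun _ => 1) (x' := fun _ => 1) (by simp) (by simp)
    (by simp) (by simp) hR hR hu hv
  have hae : ∀ᵐ α ∂d2α,
      ((besselWeight (order p j) (order p j) (‖α‖ ^ 2) : ℝ) : ℂ) *
          (inner ℂ u (cohRaw p ζ α) * inner ℂ (cohEven p ζ α) v) +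
        ((besselWeight (order p j) (order p j + 1) (‖α‖ ^ 2) : ℝ) : ℂ) *
          (inner ℂ u (cohRaw p ζ α) * inner ℂ (cohOdd p ζ α) v) =
      inner ℂ u ((((‖α‖ ^ 2 * (besselI (order p j) (‖α‖ ^ 2) +
        besselI (order p j + 1) (‖α‖ ^ 2)) : ℝ) : ℂ) •
        (((besselK (order p j) (‖α‖ ^ 2) + besselK (order p j + 1) (‖α‖ ^ 2) : ℝ) : ℂ) •
            ketBra (coh p ζ α) (coh p ζ α)
          + ((besselK (order p j) (‖α‖ ^ 2) - besselK (order p j + 1) (‖α‖ ^ 2) : ℝ) : ℂ) •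
            ketBra (coh p ζ α) (coh p ζ (-α)))) v) := by
    filter_upwards [ae_d2α_ne_zero] with α hα
    have hn : ‖cohRaw p ζ α‖ ≠ 0 := norm_ne_zero_iff.2 (hζ.cohRaw_ne_zero hp α)
    rw [hζ.besselI_order hp hα, hζ.besselI_order_add_one hp hα, ← mul_add,
      ← hζ.norm_cohRaw_sq hp]
    simp only [smul_apply, add_apply, inner_smul_right,
      inner_add_right, inner_ketBra, coh, hζ.norm_cohRaw_neg hp, inner_smul_left,
      Complex.conj_ofReal]
    have e1 : (inner ℂ (cohRaw p ζ α) v : ℂ) =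
        inner ℂ (cohEven p ζ α) v + inner ℂ (cohOdd p ζ α) v := by
      rw [cohRaw_eq_add, inner_add_left]
    have e2 : (inner ℂ (cohRaw p ζ (-α)) v : ℂ) =
        inner ℂ (cohEven p ζ α) v - inner ℂ (cohOdd p ζ α) v := by
      rw [cohRaw_neg_eq_sub, inner_sub_left]
    rw [e1, e2, besselWeight, besselWeight]
    have hn' : ((‖cohRaw p ζ α‖ : ℝ) : ℂ) ≠ 0 := by exact_mod_cast hn
    push_cast
    field_simp
    ring
  exact ⟨H.1.congr hae, (integral_congr_ae hae).symm.trans H.2⟩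

theorem integralIsIdentityOn_cat (hp : 1 < p) (hζ : IsZeroMode p j k ζ) :
    IntegralIsIdentityOn (cyclicSubspace p ζ) ((2 : ℝ≥0∞) • d2α) (fun α =>
      ((‖α‖ ^ 2 : ℝ) : ℂ) •
        (((besselI (order p j) (‖α‖ ^ 2) * besselK (order p j) (‖α‖ ^ 2) : ℝ) : ℂ) •
            ketBra (catPlus p ζ α) (catPlus p ζ α)
          + ((besselI (order p j + 1) (‖α‖ ^ 2) * besselK (order p j + 1) (‖α‖ ^ 2) : ℝ) : ℂ) •
            ketBra (catMinus p ζ α) (catMinus p ζ α))) := by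
  intro u hu v hv
  have hE : ∀ n α, inner ℂ (numberState p j ζ n) (cohEven p ζ α) =
      (evenMask n : ℂ) * (α ^ n * (((Real.sqrt (normSq p j n))⁻¹ : ℝ) : ℂ)) := fun n α => by
    rw [hζ.inner_cohEven hp, evenMask]; split_ifs <;> simp
  have hO : ∀ n α, inner ℂ (numberState p j ζ n) (cohOdd p ζ α) =
      (oddMask n : ℂ) * (α ^ n * (((Real.sqrt (normSq p j n))⁻¹ : ℝ) : ℂ)) := fun n α => by
    rw [hζ.inner_cohOdd hp, oddMask]; split_ifs <;> simp
  have H := hζ.integral_two_weights hp evenMask_sq_le oddMask_sq_le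
    (fun n => by unfold evenMask; split_ifs <;> simp)
    (fun n => by unfold oddMask; split_ifs <;> simp) hE hO hu hv
  -- The factor 1/2 removes the 2 contained in `besselWeight`; the doubled measure restores it.
  have hae : ∀ᵐ α ∂d2α,
      2⁻¹ * (((besselWeight (order p j) (order p j) (‖α‖ ^ 2) : ℝ) : ℂ) *
          (inner ℂ u (cohEven p ζ α) * inner ℂ (cohEven p ζ α) v) +
        ((besselWeight (order p j) (order p j + 1) (‖α‖ ^ 2) : ℝ) : ℂ) *
          (inner ℂ u (cohOdd p ζ α) * inner ℂ (cohOdd p ζ α) v)) =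
      inner ℂ u ((((‖α‖ ^ 2 : ℝ) : ℂ) •
        (((besselI (order p j) (‖α‖ ^ 2) * besselK (order p j) (‖α‖ ^ 2) : ℝ) : ℂ) •
            ketBra (catPlus p ζ α) (catPlus p ζ α)
          + ((besselI (order p j + 1) (‖α‖ ^ 2) * besselK (order p j + 1) (‖α‖ ^ 2) : ℝ) : ℂ) •
            ketBra (catMinus p ζ α) (catMinus p ζ α))) v) := by
    filter_upwards [ae_d2α_ne_zero] with α hα
    have hn : ((‖cohEven p ζ α‖ : ℝ) : ℂ) ≠ 0 := by
      exact_mod_cast norm_ne_zero_iff.2 (hζ.cohEven_ne_zero hp α)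
    have hn' : ((‖cohOdd p ζ α‖ : ℝ) : ℂ) ≠ 0 := by
      exact_mod_cast norm_ne_zero_iff.2 (hζ.cohOdd_ne_zero hp hα)
    rw [hζ.besselI_order hp hα, hζ.besselI_order_add_one hp hα, hζ.catPlus_eq hp,
      hζ.catMinus_eq hp]
    simp only [smul_apply, add_apply, inner_smul_right,
      inner_add_right, inner_ketBra, inner_smul_left, Complex.conj_ofReal]
    rw [besselWeight, besselWeight]
    push_cast
    field_simp
  refine ⟨((H.1.const_mul 2⁻¹).congr hae).smul_measure (by simp), ?_⟩
  rw [integral_smul_measure, ← integral_congr_ae hae, integral_const_mul, H.2]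
  simp

end IsZeroMode

lemma besselI_order_pos {p : ℝ} (hp : 1 < p) (j : ℕ) {ρ : ℝ} (hρ : 0 < ρ) :
    0 < besselI (order p j) (ρ ^ 2) ∧ 0 < besselI (order p j + 1) (ρ ^ 2) := by
  -- Any zero mode with first index j serves, here k = j: positivity of I is read off from norms of
  -- nonzero vectors at α = ρ.
  obtain ⟨ζ, hζ, -⟩ := exists_unique_zeroMode hp (le_refl j)
  have hα : (ρ : ℂ) ≠ 0 := by exact_mod_cast hρ.ne'
  have hn : ‖(ρ : ℂ)‖ = ρ := by rw [Complex.norm_real, Real.norm_of_nonneg hρ.le]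
  have h1 := hζ.besselI_order hp hα
  have h2 := hζ.besselI_order_add_one hp hα
  have hκ := besselRatio_pos hp j (show 0 < ρ ^ 2 by positivity)
  rw [hn] at h1 h2
  rw [h1, h2]
  have := norm_pos_iff.2 (hζ.cohEven_ne_zero hp (ρ : ℂ))
  have := norm_pos_iff.2 (hζ.cohOdd_ne_zero hp hα)
  constructor <;> positivity

end Paraboson

end

open Paraboson in
theorem mainTheorem3 (p : ℝ) (hp : 1 < p) (j k : ℕ) (hjk : j ≤ k) :
    -- the state `|ζ_{jk}⟩` exists, and is unique up to a phase
    (∃ ζ : FinVec, IsZeroMode p j k ζ ∧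
      ∀ ζ' : FinVec, IsZeroMode p j k ζ' → ∃ c : ℂ, ‖c‖ = 1 ∧ ζ' = c • ζ) ∧
    -- the weights of the diagonal decomposition are positive
    (∀ ρ : ℝ, 0 < ρ →
      0 < ρ ^ 2 * (besselI (p / 2 + j - 1) (ρ ^ 2) * besselK (p / 2 + j - 1) (ρ ^ 2)) ∧
      0 < ρ ^ 2 * (besselI (p / 2 + j) (ρ ^ 2) * besselK (p / 2 + j) (ρ ^ 2))) ∧
    ∀ ζ : FinVec, IsZeroMode p j k ζ →
      -- the coherent states and cat states are well-defined unit vectors of the subspace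
      (∀ α : ℂ, Summable (vertexTerm p ζ α) ∧
        coh p ζ α ∈ cyclicSubspace p ζ ∧ ‖coh p ζ α‖ = 1) ∧
      (∀ α : ℂ, α ≠ 0 →
        catPlus p ζ α ∈ cyclicSubspace p ζ ∧ ‖catPlus p ζ α‖ = 1 ∧
        catMinus p ζ α ∈ cyclicSubspace p ζ ∧ ‖catMinus p ζ α‖ = 1) ∧
      -- the number states are an orthonormal basis of the subspace
      Orthonormal ℂ (numberState p j ζ) ∧
      (∀ n, numberState p j ζ n ∈ cyclicSubspace p ζ) ∧
      (∀ v ∈ cyclicSubspace p ζ,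
        HasSum (fun n => ketBra (numberState p j ζ n) (numberState p j ζ n) v) v) ∧
      -- the decomposition of unity with off-diagonal terms
      IntegralIsIdentityOn (cyclicSubspace p ζ) d2α (fun α =>
        ((‖α‖ ^ 2 * (besselI (p / 2 + j - 1) (‖α‖ ^ 2) + besselI (p / 2 + j) (‖α‖ ^ 2)) : ℝ) : ℂ) •
          (((besselK (p / 2 + j - 1) (‖α‖ ^ 2) + besselK (p / 2 + j) (‖α‖ ^ 2) : ℝ) : ℂ) •
              ketBra (coh p ζ α) (coh p ζ α)
            + ((besselK (p / 2 + j - 1) (‖α‖ ^ 2) - besselK (p / 2 + j) (‖α‖ ^ 2) : ℝ) : ℂ) •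
              ketBra (coh p ζ α) (coh p ζ (-α)))) ∧
      -- the diagonal decomposition, with measure `ρ dρ dθ / π`
      IntegralIsIdentityOn (cyclicSubspace p ζ) ((2 : ℝ≥0∞) • d2α) (fun α =>
        ((‖α‖ ^ 2 : ℝ) : ℂ) •
          (((besselI (p / 2 + j - 1) (‖α‖ ^ 2) * besselK (p / 2 + j - 1) (‖α‖ ^ 2) : ℝ) : ℂ) •
              ketBra (catPlus p ζ α) (catPlus p ζ α)
            + ((besselI (p / 2 + j) (‖α‖ ^ 2) * besselK (p / 2 + j) (‖α‖ ^ 2) : ℝ) : ℂ) •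
              ketBra (catMinus p ζ α) (catMinus p ζ α))) := by
  have ho : p / 2 + (j : ℝ) - 1 = order p j := rfl
  have ho' : p / 2 + (j : ℝ) = order p j + 1 := by rw [order]; ring
  rw [ho, ho']
  refine ⟨exists_unique_zeroMode hp hjk, fun ρ hρ => ?_, fun ζ hζ => ⟨fun α => ?_, fun α hα => ?_,
    hζ.orthonormal_numberState hp, IsZeroMode.numberState_mem, fun v hv => ?_,
    hζ.integralIsIdentityOn_coh hp, hζ.integralIsIdentityOn_cat hp⟩⟩
  · obtain ⟨h1, h2⟩ := besselI_order_pos hp j hρ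
    have hr : 0 < ρ ^ 2 := by positivity
    exact ⟨mul_pos hr (mul_pos h1 (besselK_pos _ hr)), mul_pos hr (mul_pos h2 (besselK_pos _ hr))⟩
  · exact ⟨hζ.summable_vertexTerm hp α, Submodule.smul_mem _ _ (hζ.cohRaw_mem hp α),
      norm_inv_norm_smul (hζ.cohRaw_ne_zero hp α)⟩
  · rw [hζ.catPlus_eq hp, hζ.catMinus_eq hp]
    exact ⟨Submodule.smul_mem _ _ (hζ.cohEven_mem hp α),
      norm_inv_norm_smul (hζ.cohEven_ne_zero hp α), Submodule.smul_mem _ _ (hζ.cohOdd_mem hp α),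
      norm_inv_norm_smul (hζ.cohOdd_ne_zero hp hα)⟩
  · simpa only [ketBra, InnerProductSpace.rankOne_apply] using hζ.hasSum_numberState hp hv
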